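/- Call integers $\alpha,\beta>1$ multiplicatively independent if $\alpha^{n_1}=\beta^{n_2}$ with $n_1,n_2\in\mathbb{N}$ forces $n_1=n_2=0$, and multiplicatively dependent otherwise. Write $\gamma^{\mathbb N}=\{\gamma^n : n\in\mathbb N\}$. Let $\mathcal{PA}(\alpha^{\mathbb N},\beta^{\mathbb N})$ be the first-order theory of the structure $\langle\mathbb Z;0,1,<,+,\alpha^{\mathbb N},\beta^{\mathbb N}\rangle$, and write $\mathcal{PA}(\gamma^{\mathbb N})$ for $\mathcal{PA}(\gamma^{\mathbb N},\gamma^{\mathbb N})$. The existential fragment of such a theory is the set of its members of the form $\exists x_1,\dots,x_m\colon\varphi(x_1,\dots,x_m)$ with $\varphi$ quantifier-free. Problem 1 is the following decision problem: given multiplicatively independent integers $\alpha,\beta>1$, numbers $z_1,\dots,z_l\in\{\alpha,\beta\}$, $r,s\ge 0$, $A\in\mathbb Z^{r\times l}$, $\mathbf b\in\mathbb Z^r$, $C\in\mathbb Z^{s\times l}$ and $\mathbf d\in\mathbb Z^s$, decide whether there are $n_1,\dots,n_l\in\mathbb N$ such that $\mathbf z=(z_1^{n_1},\dots,z_l^{n_l})$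 satisfies $A\mathbf z>\mathbf b$ (componentwise) and $C\mathbf z=\mathbf d$. **Lemma.** (a) There are a computable function $\gamma(\alpha,\beta)$ and a computable function $f$ such that, for all multiplicatively dependent integers $\alpha,\beta>1$, the integer $\gamma=\gamma(\alpha,\beta)$ is greater than $1$, and for every existential sentence $\varphi$, $f(\alpha,\beta,\varphi)$ is an existential sentence with $$\varphi\in\mathcal{PA}(\alpha^{\mathbb N},\beta^{\mathbb N})\iff f(\alpha,\beta,\varphi)\in\mathcal{PA}(\gamma^{\mathbb N}).$$ In particular, deciding the existential fragment of $\mathcal{PA}(\alpha^{\mathbb N},\beta^{\mathbb N})$ reduces to deciding the existential fragment of $\mathcal{PA}(\gamma^{\mathbb N})$ for some integer $\gamma>1$. (b) There is a computable function $g$ such that, for all multiplicatively independent integers $\alpha,\beta>1$ and every existential sentence $\varphi$, $g(\alpha,\beta,\varphi)$ is an instance of Problem 1 (in general with other numbers $\alpha',\beta'$ in place of $\alpha,\beta$), and $\varphi\in\mathcal{PA}(\alpha^{\mathbb N},\beta^{\mathbb N})$ if and only if the answer to this instance is positive. In particular, deciding the existential fragment of $\mathcal{PA}(\alpha^{\mathbb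 N},\beta^{\mathbb N})$ reduces to Problem 1. -/

import Mathlib

/-- `α` and `β` are multiplicatively independent. -/
def MultIndep (α β : ℕ) : Prop :=
  ∀ n₁ n₂ : ℕ, α ^ n₁ = β ^ n₂ → n₁ = 0 ∧ n₂ = 0

/-! ### Existential sentences over `⟨ℤ; 0, 1, <, +, α^ℕ, β^ℕ⟩` -/

/-- Terms built from `0`, `1`, `+` and the variables `x₀, x₁, x₂, …`. -/
inductive PATerm : Type
  | zero : PATerm
  | one : PATerm
  | var : ℕ → PATerm
  | add : PATerm → PATerm → PATerm

/-- Quantifier-free formulas with equality, the order relation and two unary predicate symbols,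
the first for the powers of `α` and the second for the powers of `β`. -/
inductive QFFormula : Type
  | eq : PATerm → PATerm → QFFormula
  | lt : PATerm → PATerm → QFFormula
  | powA : PATerm → QFFormula
  | powB : PATerm → QFFormula
  | not : QFFormula → QFFormula
  | and : QFFormula → QFFormula → QFFormula
  | or : QFFormula → QFFormula → QFFormula

/-- The integer denoted by a term under the assignment `v`. -/
def PATerm.eval (v : ℕ → ℤ) : PATerm → ℤ
  | zero => 0
  | one => 1
  | var i => v i
  | add s t => s.eval v + t.eval v

/-- Satisfaction in `⟨ℤ; 0, 1, <, +, α^ℕ, β^ℕ⟩` under the assignment `v`. -/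
def QFFormula.Holds (α β : ℕ) (v : ℕ → ℤ) : QFFormula → Prop
  | eq s t => s.eval v = t.eval v
  | lt s t => s.eval v < t.eval v
  | powA t => ∃ n : ℕ, t.eval v = (α : ℤ) ^ n
  | powB t => ∃ n : ℕ, t.eval v = (β : ℤ) ^ n
  | not φ => ¬ φ.Holds α β v
  | and φ ψ => φ.Holds α β v ∧ ψ.Holds α β v
  | or φ ψ => φ.Holds α β v ∨ ψ.Holds α β v

/-- The existential fragment of the theory of `⟨ℤ; 0, 1, <, +, α^ℕ, β^ℕ⟩`. An existential sentence
`∃ x₀ … xₘ, φ` is given by its quantifier-free matrix `φ`, all variables of which are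
existentially quantified. -/
def ExistentialPA (α β : ℕ) : Set QFFormula :=
  {φ | ∃ v : ℕ → ℤ, φ.Holds α β v}

/-- The existential fragment of the theory with the single power predicate `γ^ℕ`, that is, the case
in which both predicate symbols denote `γ^ℕ`. -/
def ExistentialPAOne (γ : ℕ) : Set QFFormula :=
  ExistentialPA γ γ

/-! ### Gödel numbering of terms and formulas by natural numbers -/

namespace PATerm

/-- The code of a term. -/
def toNat : PATerm → ℕ
  | zero => 0
  | one => 1
  | var i => 2 * i + 2
  | add s t => 2 * Nat.pair s.toNat t.toNat + 3

/-- The term with a given code. -/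
def ofNat : ℕ → PATerm
  | 0 => zero
  | 1 => one
  | n + 2 =>
    have h₁ : (n / 2).unpair.1 < n + 2 :=
      lt_of_le_of_lt (Nat.unpair_left_le _) (by omega)
    have h₂ : (n / 2).unpair.2 < n + 2 :=
      lt_of_le_of_lt (Nat.unpair_right_le _) (by omega)
    if n % 2 = 0 then var (n / 2)
    else add (ofNat (n / 2).unpair.1) (ofNat (n / 2).unpair.2)

theorem ofNat_toNat (t : PATerm) : ofNat t.toNat = t := by
  induction t with
  | zero => simp [toNat, ofNat]
  | one => simp [toNat, ofNat]
  | var i => simp [toNat, ofNat]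
  | add s t hs ht =>
    have e : toNat (add s t) = (2 * Nat.pair s.toNat t.toNat + 1) + 2 := rfl
    have h₁ : (2 * Nat.pair s.toNat t.toNat + 1) / 2 = Nat.pair s.toNat t.toNat := by omega
    rw [e, ofNat, if_neg (by omega), h₁, Nat.unpair_pair, hs, ht]

theorem toNat_ofNat (n : ℕ) : (ofNat n).toNat = n := by
  induction n using Nat.strong_induction_on with
  | _ n ih =>
    match n with
    | 0 => simp [toNat, ofNat]
    | 1 => simp [toNat, ofNat]
    | n + 2 =>
      have h₁ : (n / 2).unpair.1 < n + 2 :=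
        lt_of_le_of_lt (Nat.unpair_left_le _) (by omega)
      have h₂ : (n / 2).unpair.2 < n + 2 :=
        lt_of_le_of_lt (Nat.unpair_right_le _) (by omega)
      rw [ofNat]
      split_ifs with h
      · simp only [toNat]; omega
      · simp only [toNat, ih _ h₁, ih _ h₂, Nat.pair_unpair]; omega

/-- The coding of terms is a bijection with `ℕ`. -/
def equivNat : PATerm ≃ ℕ := ⟨toNat, ofNat, ofNat_toNat, toNat_ofNat⟩

instance : Denumerable PATerm := Denumerable.mk' equivNat

end PATerm

namespace QFFormula

/-- The code of a formula. -/
def toNat : QFFormula → ℕ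
  | eq s t => 7 * Nat.pair s.toNat t.toNat
  | lt s t => 7 * Nat.pair s.toNat t.toNat + 1
  | powA t => 7 * t.toNat + 2
  | powB t => 7 * t.toNat + 3
  | not φ => 7 * φ.toNat + 4
  | and φ ψ => 7 * Nat.pair φ.toNat ψ.toNat + 5
  | or φ ψ => 7 * Nat.pair φ.toNat ψ.toNat + 6

/-- The formula with a given code. -/
def ofNat (n : ℕ) : QFFormula :=
  have h₁ : (n / 7).unpair.1 ≤ n / 7 := Nat.unpair_left_le _
  have h₂ : (n / 7).unpair.2 ≤ n / 7 := Nat.unpair_right_le _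
  if n % 7 = 0 then eq (PATerm.ofNat (n / 7).unpair.1) (PATerm.ofNat (n / 7).unpair.2)
  else if n % 7 = 1 then lt (PATerm.ofNat (n / 7).unpair.1) (PATerm.ofNat (n / 7).unpair.2)
  else if n % 7 = 2 then powA (PATerm.ofNat (n / 7))
  else if n % 7 = 3 then powB (PATerm.ofNat (n / 7))
  else if n % 7 = 4 then not (ofNat (n / 7))
  else if n % 7 = 5 then and (ofNat (n / 7).unpair.1) (ofNat (n / 7).unpair.2)
  else or (ofNat (n / 7).unpair.1) (ofNat (n / 7).unpair.2)
termination_by n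
decreasing_by all_goals omega

theorem ofNat_toNat (φ : QFFormula) : ofNat φ.toNat = φ := by
  have d : ∀ a k : ℕ, k < 7 → (7 * a + k) / 7 = a ∧ (7 * a + k) % 7 = k := by omega
  induction φ with
  | eq s t =>
    have h := d (Nat.pair s.toNat t.toNat) 0 (by omega)
    rw [toNat, ofNat]
    simp only [Nat.add_zero] at h
    simp [h, PATerm.ofNat_toNat]
  | lt s t =>
    have h := d (Nat.pair s.toNat t.toNat) 1 (by omega)
    rw [toNat, ofNat]; simp [h, PATerm.ofNat_toNat]
  | powA t =>
    have h := d t.toNat 2 (by omega)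
    rw [toNat, ofNat]; simp [h, PATerm.ofNat_toNat]
  | powB t =>
    have h := d t.toNat 3 (by omega)
    rw [toNat, ofNat]; simp [h, PATerm.ofNat_toNat]
  | not φ hφ =>
    have h := d φ.toNat 4 (by omega)
    rw [toNat, ofNat]; simp [h, hφ]
  | and φ ψ hφ hψ =>
    have h := d (Nat.pair φ.toNat ψ.toNat) 5 (by omega)
    rw [toNat, ofNat]; simp [h, hφ, hψ]
  | or φ ψ hφ hψ =>
    have h := d (Nat.pair φ.toNat ψ.toNat) 6 (by omega)
    rw [toNat, ofNat]; simp [h, hφ, hψ]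

theorem toNat_ofNat (n : ℕ) : (ofNat n).toNat = n := by
  induction n using Nat.strong_induction_on with
  | _ n ih =>
    have h₁ : (n / 7).unpair.1 ≤ n / 7 := Nat.unpair_left_le _
    have h₂ : (n / 7).unpair.2 ≤ n / 7 := Nat.unpair_right_le _
    rw [ofNat]
    split_ifs
    · simp only [toNat, PATerm.toNat_ofNat, Nat.pair_unpair]; omega
    · simp only [toNat, PATerm.toNat_ofNat, Nat.pair_unpair]; omega
    · simp only [toNat, PATerm.toNat_ofNat]; omega
    · simp only [toNat, PATerm.toNat_ofNat]; omega
    · simp only [toNat, ih (n / 7) (by omega)]; omega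
    · simp only [toNat, ih (n / 7).unpair.1 (by omega), ih (n / 7).unpair.2 (by omega),
        Nat.pair_unpair]; omega
    · simp only [toNat, ih (n / 7).unpair.1 (by omega), ih (n / 7).unpair.2 (by omega),
        Nat.pair_unpair]; omega

/-- The coding of formulas is a bijection with `ℕ`. -/
def equivNat : QFFormula ≃ ℕ := ⟨toNat, ofNat, ofNat_toNat, toNat_ofNat⟩

instance : Denumerable QFFormula := Denumerable.mk' equivNat

end QFFormula

/-! ### Systems of linear constraints on powers -/

/-- Finite data of a problem instance: numbers `α, β`, bases `z₁, …, z_l`, the rows `(aⱼ, bⱼ)` of a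
system of strict inequalities `A z > b`, and the rows `(cⱼ, dⱼ)` of a system of equations
`C z = d`. -/
structure PowerSystem where
  α : ℕ
  β : ℕ
  bases : List ℕ
  ineqs : List (List ℤ × ℤ)
  eqns : List (List ℤ × ℤ)

namespace PowerSystem

/-- A power system as a tuple of numbers and lists. -/
def equivTuple :
    PowerSystem ≃ ℕ × ℕ × List ℕ × List (List ℤ × ℤ) × List (List ℤ × ℤ) where
  toFun S := (S.α, S.β, S.bases, S.ineqs, S.eqns)
  invFun p := ⟨p.1, p.2.1, p.2.2.1, p.2.2.2.1, p.2.2.2.2⟩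

instance : Primcodable PowerSystem := Primcodable.ofEquiv _ equivTuple

/-- The data form an instance of the problem: `α, β > 1` are multiplicatively independent, every
base is `α` or `β`, and every row of the matrices `A` and `C` has `l` entries. -/
def IsInstance (S : PowerSystem) : Prop :=
  1 < S.α ∧ 1 < S.β ∧ MultIndep S.α S.β ∧
  (∀ z ∈ S.bases, z = S.α ∨ z = S.β) ∧
  (∀ row ∈ S.ineqs, row.1.length = S.bases.length) ∧
  (∀ row ∈ S.eqns, row.1.length = S.bases.length)

/-- The value `c₁ z₁^{n₁} + ⋯ + c_l z_l^{n_l}`. -/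
def linForm (S : PowerSystem) (c : List ℤ) (n : Fin S.bases.length → ℕ) : ℤ :=
  ∑ i : Fin S.bases.length, c.getD i 0 * (S.bases.get i : ℤ) ^ n i

/-- Some `z = (z₁^{n₁}, …, z_l^{n_l})` satisfies `A z > b` and `C z = d`. -/
def Solvable (S : PowerSystem) : Prop :=
  ∃ n : Fin S.bases.length → ℕ,
    (∀ row ∈ S.ineqs, S.linForm row.1 n > row.2) ∧
    (∀ row ∈ S.eqns, S.linForm row.1 n = row.2)

end PowerSystem

/-! ### Closure properties of primitive recursive functions -/

attribute [fun_prop] Primrec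

namespace Primrec

variable {α β γ σ : Type*} [Primcodable α] [Primcodable β] [Primcodable γ] [Primcodable σ]

attribute [fun_prop] Primrec.comp Primrec.const Primrec.id Primrec.pair

@[fun_prop] theorem id_fun : Primrec fun x : α => x := Primrec.id

@[fun_prop] theorem fst_fun {f : α → β × γ} (hf : Primrec f) : Primrec fun a => (f a).1 :=
  fst.comp hf

@[fun_prop] theorem snd_fun {f : α → β × γ} (hf : Primrec f) : Primrec fun a => (f a).2 :=
  snd.comp hf

@[fun_prop] theorem add_fun {f g : α → ℕ} (hf : Primrec f) (hg : Primrec g) :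
    Primrec fun a => f a + g a := nat_add.comp hf hg

@[fun_prop] theorem mul_fun {f g : α → ℕ} (hf : Primrec f) (hg : Primrec g) :
    Primrec fun a => f a * g a := nat_mul.comp hf hg

@[fun_prop] theorem sub_fun {f g : α → ℕ} (hf : Primrec f) (hg : Primrec g) :
    Primrec fun a => f a - g a := nat_sub.comp hf hg

@[fun_prop] theorem div_fun {f g : α → ℕ} (hf : Primrec f) (hg : Primrec g) :
    Primrec fun a => f a / g a := nat_div.comp hf hg

@[fun_prop] theorem mod_fun {f g : α → ℕ} (hf : Primrec f) (hg : Primrec g) :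
    Primrec fun a => f a % g a := nat_mod.comp hf hg

@[fun_prop] theorem natPair_fun {f g : α → ℕ} (hf : Primrec f) (hg : Primrec g) :
    Primrec fun a => Nat.pair (f a) (g a) := Primrec₂.natPair.comp hf hg

@[fun_prop] theorem unpair_fun {f : α → ℕ} (hf : Primrec f) :
    Primrec fun a => Nat.unpair (f a) := unpair.comp hf

@[fun_prop] theorem bif_fun {c : α → Bool} {f g : α → β} (hc : Primrec c) (hf : Primrec f)
    (hg : Primrec g) : Primrec fun a => bif c a then f a else g a := cond hc hf hg

@[fun_prop] theorem beq_fun [DecidableEq β] {f g : α → β} (hf : Primrec f) (hg : Primrec g) :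
    Primrec fun a => f a == g a := Primrec.beq.comp hf hg

@[fun_prop] theorem ble_fun {f g : α → ℕ} (hf : Primrec f) (hg : Primrec g) :
    Primrec fun a => Nat.ble (f a) (g a) :=
  ((nat_le.comp hf hg).decide).of_eq fun a => by
    rw [Bool.eq_iff_iff]; simp

@[fun_prop] theorem and_fun {f g : α → Bool} (hf : Primrec f) (hg : Primrec g) :
    Primrec fun a => f a && g a := Primrec.and.comp hf hg

@[fun_prop] theorem or_fun {f g : α → Bool} (hf : Primrec f) (hg : Primrec g) :
    Primrec fun a => f a || g a := Primrec.or.comp hf hg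

@[fun_prop] theorem not_fun {f : α → Bool} (hf : Primrec f) :
    Primrec fun a => !f a := Primrec.not.comp hf

@[fun_prop] theorem list_map_fun {f : α → List β} {g : α → β → γ} (hf : Primrec f)
    (hg : Primrec fun p : α × β => g p.1 p.2) : Primrec fun a => (f a).map (g a) :=
  list_map hf hg

@[fun_prop] theorem list_flatMap_fun {f : α → List β} {g : α → β → List γ} (hf : Primrec f)
    (hg : Primrec fun p : α × β => g p.1 p.2) : Primrec fun a => (f a).flatMap (g a) :=
  list_flatMap hf hg

@[fun_prop] theorem list_foldr_fun {f : α → List β} {g : α → γ} {h : α → β → γ → γ}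
    (hf : Primrec f) (hg : Primrec g) (hh : Primrec fun p : α × β × γ => h p.1 p.2.1 p.2.2) :
    Primrec fun a => (f a).foldr (h a) (g a) :=
  list_foldr (h := fun a p => h a p.1 p.2) hf hg hh

@[fun_prop] theorem list_range_fun {f : α → ℕ} (hf : Primrec f) :
    Primrec fun a => List.range (f a) := list_range.comp hf

@[fun_prop] theorem list_cons_fun {f : α → β} {g : α → List β} (hf : Primrec f)
    (hg : Primrec g) : Primrec fun a => f a :: g a := list_cons.comp hf hg

@[fun_prop] theorem list_append_fun {f g : α → List β} (hf : Primrec f)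
    (hg : Primrec g) : Primrec fun a => f a ++ g a := list_append.comp hf hg

@[fun_prop] theorem nat_rec_fun {f : α → ℕ} {g : α → β} {h : α → ℕ → β → β} (hf : Primrec f)
    (hg : Primrec g) (hh : Primrec fun p : α × ℕ × β => h p.1 p.2.1 p.2.2) :
    Primrec fun a => (Nat.rec (g a) (h a) (f a) : β) :=
  nat_rec' (h := fun a p => h a p.1 p.2) hf hg hh

@[fun_prop] theorem nat_iterate_fun {f : α → ℕ} {g : α → β} {h : α → β → β} (hf : Primrec f)
    (hg : Primrec g) (hh : Primrec fun p : α × β => h p.1 p.2) :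
    Primrec fun a => (h a)^[f a] (g a) := nat_iterate hf hg hh

@[fun_prop] theorem pow_fun {f g : α → ℕ} (hf : Primrec f) (hg : Primrec g) :
    Primrec fun a => f a ^ g a :=
  (nat_rec_fun (h := fun a _ r => r * f a) hg (const 1) (by fun_prop)).of_eq fun a => by
    induction g a with
    | zero => rfl
    | succ n ih => rw [pow_succ, ← ih]

@[fun_prop] theorem factorial_fun {f : α → ℕ} (hf : Primrec f) :
    Primrec fun a => (f a).factorial :=
  (nat_rec_fun (h := fun _ n r => (n + 1) * r) hf (const 1) (by fun_prop)).of_eq fun a => by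
    induction f a with
    | zero => rfl
    | succ n ih => rw [Nat.factorial_succ, ← ih]

@[fun_prop] theorem nat_cast_int {f : α → ℕ} (hf : Primrec f) : Primrec fun a => (f a : ℤ) := by
  refine encode_iff.1 ((mul_fun (const 2) hf).of_eq fun a => ?_)
  rfl

theorem nat_sub_int {f g : α → ℕ} (hf : Primrec f) (hg : Primrec g) :
    Primrec fun a => (f a : ℤ) - g a := by
  have h : Primrec fun a => bif Nat.ble (g a) (f a) then 2 * (f a - g a)
      else 2 * (g a - f a - 1) + 1 := by fun_prop
  refine encode_iff.1 (h.of_eq fun a => ?_)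
  by_cases hle : g a ≤ f a
  · have : (f a : ℤ) - g a = ((f a - g a : ℕ) : ℤ) := by omega
    rw [this, Nat.ble_eq_true_of_le hle]; rfl
  · have : (f a : ℤ) - g a = Int.negSucc (g a - f a - 1) := by omega
    have hb : Nat.ble (g a) (f a) = false := by
      rw [← Bool.not_eq_true, Nat.ble_eq]; exact hle
    rw [this, hb]; rfl

@[fun_prop] theorem int_toNat {f : α → ℤ} (hf : Primrec f) : Primrec fun a => (f a).toNat := by
  have h : Primrec fun a => bif Encodable.encode (f a) % 2 == 0 then Encodable.encode (f a) / 2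
      else 0 := by
    have := Primrec.encode.comp hf
    fun_prop
  refine h.of_eq fun a => ?_
  rcases f a with n | n
  · have : Encodable.encode (n : ℤ) = 2 * n := rfl
    simp [this]
  · have : Encodable.encode (Int.negSucc n) = 2 * n + 1 := rfl
    have h2 : (2 * n + 1) % 2 = 1 := by omega
    simp [this, h2]

@[fun_prop] theorem int_neg_toNat {f : α → ℤ} (hf : Primrec f) :
    Primrec fun a => (-f a).toNat := by
  have h : Primrec fun a => bif Encodable.encode (f a) % 2 == 0 then 0
      else Encodable.encode (f a) / 2 + 1 := by
    have := Primrec.encode.comp hf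
    fun_prop
  refine h.of_eq fun a => ?_
  rcases f a with n | n
  · have : Encodable.encode (n : ℤ) = 2 * n := rfl
    simp [this]
  · have : Encodable.encode (Int.negSucc n) = 2 * n + 1 := rfl
    have h2 : (2 * n + 1) % 2 = 1 := by omega
    have h3 : (2 * n + 1) / 2 = n := by omega
    simp [this, h2, h3]

@[fun_prop] theorem int_neg {f : α → ℤ} (hf : Primrec f) : Primrec fun a => -f a :=
  (nat_sub_int (int_neg_toNat hf) (int_toNat hf)).of_eq fun a => by omega

@[fun_prop] theorem int_add {f g : α → ℤ} (hf : Primrec f) (hg : Primrec g) :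
    Primrec fun a => f a + g a :=
  (nat_sub_int (add_fun (int_toNat hf) (int_toNat hg))
    (add_fun (int_neg_toNat hf) (int_neg_toNat hg))).of_eq fun a => by omega

@[fun_prop] theorem int_sub {f g : α → ℤ} (hf : Primrec f) (hg : Primrec g) :
    Primrec fun a => f a - g a :=
  (int_add hf (int_neg hg)).of_eq fun a => by omega

@[fun_prop] theorem int_mul {f g : α → ℤ} (hf : Primrec f) (hg : Primrec g) :
    Primrec fun a => f a * g a :=
  (nat_sub_int
    (add_fun (mul_fun (int_toNat hf) (int_toNat hg))
      (mul_fun (int_neg_toNat hf) (int_neg_toNat hg)))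
    (add_fun (mul_fun (int_toNat hf) (int_neg_toNat hg))
      (mul_fun (int_neg_toNat hf) (int_toNat hg)))).of_eq fun a => by
    have h1 : f a = (f a).toNat - (-f a).toNat := by omega
    have h2 : g a = (g a).toNat - (-g a).toNat := by omega
    conv_rhs => rw [h1, h2]
    push_cast
    ring

@[fun_prop] theorem int_pow {f : α → ℤ} {g : α → ℕ} (hf : Primrec f) (hg : Primrec g) :
    Primrec fun a => f a ^ g a :=
  (nat_rec_fun (h := fun a _ r => r * f a) hg (const 1) (by fun_prop)).of_eq fun a => by
    induction g a with
    | zero => simp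
    | succ n ih => rw [pow_succ, ← ih]

@[fun_prop] theorem sum_range_fun {f : α → ℕ} {g : α → ℕ → ℤ} (hf : Primrec f)
    (hg : Primrec fun p : α × ℕ => g p.1 p.2) :
    Primrec fun a => ∑ i ∈ Finset.range (f a), g a i := by
  have : Primrec fun p : α × ℕ × ℤ => g p.1 p.2.1 :=
    hg.comp (f := fun p : α × ℕ => g p.1 p.2) (g := fun p : α × ℕ × ℤ => (p.1, p.2.1))
      (by fun_prop)
  exact (nat_rec_fun (h := fun a n r => r + g a n) hf (const 0) (by fun_prop)).of_eq fun a => by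
    induction f a with
    | zero => rfl
    | succ n ih => rw [Finset.sum_range_succ, ← ih]

/-- Whether `m` divides an integer is decided by a primitive recursive function. -/
@[fun_prop] theorem dvd_fun {f : α → ℕ} {g : α → ℤ} (hf : Primrec f) (hg : Primrec g) :
    Primrec fun a => decide ((f a : ℤ) ∣ g a) := by
  have h : Primrec fun a => ((g a).toNat % f a == 0) && ((-g a).toNat % f a == 0) := by fun_prop
  refine h.of_eq fun a => ?_
  rw [Bool.eq_iff_iff]
  simp only [Bool.and_eq_true, beq_iff_eq, decide_eq_true_eq, ← Nat.dvd_iff_mod_eq_zero]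
  rcases le_total 0 (g a) with h | h
  · have h2 : (-g a).toNat = 0 := by omega
    rw [h2, ← Int.natCast_dvd_natCast, Int.toNat_of_nonneg h]
    simp
  · have h2 : (g a).toNat = 0 := by omega
    rw [h2, ← Int.natCast_dvd_natCast (n := (-g a).toNat), Int.toNat_of_nonneg (by omega)]
    simp

theorem option_bind_fun {f : α → Option β} {g : α → β → Option σ} (hf : Primrec f)
    (hg : Primrec fun p : α × β => g p.1 p.2) : Primrec fun a => (f a).bind (g a) :=
  option_bind hf hg

end Primrec

/-! ### Recursion on terms and formulas -/

section

variable {α σ : Type*} [Primcodable α] [Primcodable σ]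

namespace PATerm

@[fun_prop] theorem primrec_toNat {f : α → PATerm} (hf : Primrec f) :
    Primrec fun a => (f a).toNat := Primrec.encode.comp hf

@[fun_prop] theorem primrec_ofNat {f : α → ℕ} (hf : Primrec f) :
    Primrec fun a => PATerm.ofNat (f a) :=
  ((Primrec.ofNat PATerm).comp hf).of_eq fun _ => rfl

@[fun_prop] theorem primrec_var {f : α → ℕ} (hf : Primrec f) :
    Primrec fun a => PATerm.var (f a) :=
  Primrec.encode_iff.1 ((show Primrec fun a => 2 * f a + 2 by fun_prop).of_eq fun _ => rfl)

@[fun_prop] theorem primrec_add {f g : α → PATerm} (hf : Primrec f) (hg : Primrec g) :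
    Primrec fun a => PATerm.add (f a) (g a) :=
  Primrec.encode_iff.1 ((show Primrec fun a => 2 * Nat.pair (f a).toNat (g a).toNat + 3 by
    fun_prop).of_eq fun _ => rfl)

/-- A function defined by structural recursion on terms is primitive recursive. -/
theorem primrec_rec {F : α → PATerm → σ} {z o : α → σ} {v : α → ℕ → σ} {d : α → σ → σ → σ}
    (hz : Primrec z) (ho : Primrec o) (hv : Primrec fun p : α × ℕ => v p.1 p.2)
    (hd : Primrec fun p : α × σ × σ => d p.1 p.2.1 p.2.2)
    (Fz : ∀ a, F a zero = z a) (Fo : ∀ a, F a one = o a) (Fv : ∀ a i, F a (var i) = v a i)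
    (Fd : ∀ a s t, F a (add s t) = d a (F a s) (F a t)) :
    Primrec fun p : α × PATerm => F p.1 p.2 := by
  let g : α → List σ → Option σ := fun a l =>
    bif l.length == 0 then some (z a) else
    bif l.length == 1 then some (o a) else
    bif (l.length - 2) % 2 == 0 then some (v a ((l.length - 2) / 2)) else
    (l[((l.length - 2) / 2).unpair.1]?).bind fun x =>
      (l[((l.length - 2) / 2).unpair.2]?).bind fun y => some (d a x y)
  have hl : Primrec fun p : α × List σ => p.2.length := Primrec.list_length.comp Primrec.snd
  have hg : Primrec₂ g := by
    have h1 : Primrec fun p : α × List σ => v p.1 ((p.2.length - 2) / 2) :=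
      hv.comp (g := fun p : α × List σ => (p.1, (p.2.length - 2) / 2)) (by fun_prop)
    have h2 : Primrec fun p : α × List σ => p.2[((p.2.length - 2) / 2).unpair.1]? :=
      Primrec.list_getElem?.comp Primrec.snd (by fun_prop)
    have h3 : Primrec fun p : α × List σ => p.2[((p.2.length - 2) / 2).unpair.2]? :=
      Primrec.list_getElem?.comp Primrec.snd (by fun_prop)
    have h4 : Primrec fun p : ((α × List σ) × σ) × σ => d p.1.1.1 p.1.2 p.2 :=
      hd.comp (g := fun p : ((α × List σ) × σ) × σ => (p.1.1.1, p.1.2, p.2)) (by fun_prop)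
    have h5 : Primrec fun p : α × List σ => (p.2[((p.2.length - 2) / 2).unpair.1]?).bind fun x =>
        (p.2[((p.2.length - 2) / 2).unpair.2]?).bind fun y => some (d p.1 x y) :=
      Primrec.option_bind_fun h2 (Primrec.option_bind_fun (h3.comp Primrec.fst)
        (Primrec.option_some.comp h4))
    have h6 := Primrec.option_some.comp h1
    have h7 := Primrec.option_some.comp (hz.comp (Primrec.fst (α := α) (β := List σ)))
    have h8 := Primrec.option_some.comp (ho.comp (Primrec.fst (α := α) (β := List σ)))
    exact (show Primrec fun p : α × List σ => g p.1 p.2 by simp only [g]; fun_prop)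
  have H : ∀ a n, g a ((List.range n).map fun k => F a (ofNat k)) = some (F a (ofNat n)) := by
    intro a n
    match n with
    | 0 => simp [g, ofNat, Fz]
    | 1 => simp [g, ofNat, Fo]
    | n + 2 =>
      have h₁ : (n / 2).unpair.1 < n + 2 := lt_of_le_of_lt (Nat.unpair_left_le _) (by omega)
      have h₂ : (n / 2).unpair.2 < n + 2 := lt_of_le_of_lt (Nat.unpair_right_le _) (by omega)
      rw [ofNat]
      by_cases h : n % 2 = 0
      · simp [g, h, Fv]
      · have h' : (n % 2 == 0) = false := by simpa using h
        simp [g, h, h', Fd, h₁, h₂]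
  have := Primrec.nat_strong_rec (fun a n => F a (ofNat n)) hg H
  refine (this.comp Primrec.fst (primrec_toNat Primrec.snd)).of_eq fun p => ?_
  rw [ofNat_toNat]

end PATerm

namespace QFFormula

@[fun_prop] theorem primrec_toNat {f : α → QFFormula} (hf : Primrec f) :
    Primrec fun a => (f a).toNat := Primrec.encode.comp hf

@[fun_prop] theorem primrec_eq {f g : α → PATerm} (hf : Primrec f) (hg : Primrec g) :
    Primrec fun a => QFFormula.eq (f a) (g a) :=
  Primrec.encode_iff.1 ((show Primrec fun a => 7 * Nat.pair (f a).toNat (g a).toNat by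
    fun_prop).of_eq fun _ => rfl)

@[fun_prop] theorem primrec_lt {f g : α → PATerm} (hf : Primrec f) (hg : Primrec g) :
    Primrec fun a => QFFormula.lt (f a) (g a) :=
  Primrec.encode_iff.1 ((show Primrec fun a => 7 * Nat.pair (f a).toNat (g a).toNat + 1 by
    fun_prop).of_eq fun _ => rfl)

@[fun_prop] theorem primrec_powA {f : α → PATerm} (hf : Primrec f) :
    Primrec fun a => QFFormula.powA (f a) :=
  Primrec.encode_iff.1 ((show Primrec fun a => 7 * (f a).toNat + 2 by
    fun_prop).of_eq fun _ => rfl)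

@[fun_prop] theorem primrec_powB {f : α → PATerm} (hf : Primrec f) :
    Primrec fun a => QFFormula.powB (f a) :=
  Primrec.encode_iff.1 ((show Primrec fun a => 7 * (f a).toNat + 3 by
    fun_prop).of_eq fun _ => rfl)

@[fun_prop] theorem primrec_not {f : α → QFFormula} (hf : Primrec f) :
    Primrec fun a => QFFormula.not (f a) :=
  Primrec.encode_iff.1 ((show Primrec fun a => 7 * (f a).toNat + 4 by
    fun_prop).of_eq fun _ => rfl)

@[fun_prop] theorem primrec_and {f g : α → QFFormula} (hf : Primrec f) (hg : Primrec g) :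
    Primrec fun a => QFFormula.and (f a) (g a) :=
  Primrec.encode_iff.1 ((show Primrec fun a => 7 * Nat.pair (f a).toNat (g a).toNat + 5 by
    fun_prop).of_eq fun _ => rfl)

@[fun_prop] theorem primrec_or {f g : α → QFFormula} (hf : Primrec f) (hg : Primrec g) :
    Primrec fun a => QFFormula.or (f a) (g a) :=
  Primrec.encode_iff.1 ((show Primrec fun a => 7 * Nat.pair (f a).toNat (g a).toNat + 6 by
    fun_prop).of_eq fun _ => rfl)

/-- A function defined by structural recursion on formulas is primitive recursive. -/
theorem primrec_rec {F : α → QFFormula → σ} {e l : α → PATerm → PATerm → σ}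
    {A B : α → PATerm → σ} {c : α → σ → σ} {k d : α → σ → σ → σ}
    (he : Primrec fun p : α × PATerm × PATerm => e p.1 p.2.1 p.2.2)
    (hl : Primrec fun p : α × PATerm × PATerm => l p.1 p.2.1 p.2.2)
    (hA : Primrec fun p : α × PATerm => A p.1 p.2) (hB : Primrec fun p : α × PATerm => B p.1 p.2)
    (hc : Primrec fun p : α × σ => c p.1 p.2)
    (hk : Primrec fun p : α × σ × σ => k p.1 p.2.1 p.2.2)
    (hd : Primrec fun p : α × σ × σ => d p.1 p.2.1 p.2.2)
    (Fe : ∀ a s t, F a (eq s t) = e a s t) (Fl : ∀ a s t, F a (lt s t) = l a s t)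
    (FA : ∀ a t, F a (powA t) = A a t) (FB : ∀ a t, F a (powB t) = B a t)
    (Fc : ∀ a φ, F a (not φ) = c a (F a φ))
    (Fk : ∀ a φ ψ, F a (and φ ψ) = k a (F a φ) (F a ψ))
    (Fd : ∀ a φ ψ, F a (or φ ψ) = d a (F a φ) (F a ψ)) :
    Primrec fun p : α × QFFormula => F p.1 p.2 := by
  let g : α → List σ → Option σ := fun a m =>
    bif m.length % 7 == 0 then some (e a (PATerm.ofNat (m.length / 7).unpair.1)
      (PATerm.ofNat (m.length / 7).unpair.2)) else
    bif m.length % 7 == 1 then some (l a (PATerm.ofNat (m.length / 7).unpair.1)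
      (PATerm.ofNat (m.length / 7).unpair.2)) else
    bif m.length % 7 == 2 then some (A a (PATerm.ofNat (m.length / 7))) else
    bif m.length % 7 == 3 then some (B a (PATerm.ofNat (m.length / 7))) else
    bif m.length % 7 == 4 then (m[m.length / 7]?).bind fun x => some (c a x) else
    bif m.length % 7 == 5 then (m[(m.length / 7).unpair.1]?).bind fun x =>
      (m[(m.length / 7).unpair.2]?).bind fun y => some (k a x y) else
    (m[(m.length / 7).unpair.1]?).bind fun x =>
      (m[(m.length / 7).unpair.2]?).bind fun y => some (d a x y)
  have hg : Primrec₂ g := by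
    have hn : Primrec fun p : α × List σ => p.2.length := Primrec.list_length.comp Primrec.snd
    have i0 : Primrec fun p : α × List σ => p.2[p.2.length / 7]? :=
      Primrec.list_getElem?.comp Primrec.snd (by fun_prop)
    have i1 : Primrec fun p : α × List σ => p.2[(p.2.length / 7).unpair.1]? :=
      Primrec.list_getElem?.comp Primrec.snd (by fun_prop)
    have i2 : Primrec fun p : α × List σ => p.2[(p.2.length / 7).unpair.2]? :=
      Primrec.list_getElem?.comp Primrec.snd (by fun_prop)
    have h1 := Primrec.option_some.comp (he.comp (g := fun p : α × List σ =>
      (p.1, PATerm.ofNat (p.2.length / 7).unpair.1, PATerm.ofNat (p.2.length / 7).unpair.2))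
      (by fun_prop))
    have h2 := Primrec.option_some.comp (hl.comp (g := fun p : α × List σ =>
      (p.1, PATerm.ofNat (p.2.length / 7).unpair.1, PATerm.ofNat (p.2.length / 7).unpair.2))
      (by fun_prop))
    have h3 := Primrec.option_some.comp (hA.comp (g := fun p : α × List σ =>
      (p.1, PATerm.ofNat (p.2.length / 7))) (by fun_prop))
    have h4 := Primrec.option_some.comp (hB.comp (g := fun p : α × List σ =>
      (p.1, PATerm.ofNat (p.2.length / 7))) (by fun_prop))
    have h5 : Primrec fun p : α × List σ =>
        (p.2[p.2.length / 7]?).bind fun x => some (c p.1 x) :=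
      Primrec.option_bind_fun i0 (Primrec.option_some.comp
        (hc.comp (g := fun p : (α × List σ) × σ => (p.1.1, p.2)) (by fun_prop)))
    have h6 : Primrec fun p : α × List σ => (p.2[(p.2.length / 7).unpair.1]?).bind fun x =>
        (p.2[(p.2.length / 7).unpair.2]?).bind fun y => some (k p.1 x y) :=
      Primrec.option_bind_fun i1 (Primrec.option_bind_fun (i2.comp Primrec.fst)
        (Primrec.option_some.comp (hk.comp
          (g := fun p : ((α × List σ) × σ) × σ => (p.1.1.1, p.1.2, p.2)) (by fun_prop))))
    have h7 : Primrec fun p : α × List σ => (p.2[(p.2.length / 7).unpair.1]?).bind fun x =>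
        (p.2[(p.2.length / 7).unpair.2]?).bind fun y => some (d p.1 x y) :=
      Primrec.option_bind_fun i1 (Primrec.option_bind_fun (i2.comp Primrec.fst)
        (Primrec.option_some.comp (hd.comp
          (g := fun p : ((α × List σ) × σ) × σ => (p.1.1.1, p.1.2, p.2)) (by fun_prop))))
    exact (show Primrec fun p : α × List σ => g p.1 p.2 by simp only [g]; fun_prop)
  have H : ∀ a n, g a ((List.range n).map fun k => F a (ofNat k)) = some (F a (ofNat n)) := by
    intro a n
    have h₁ : (n / 7).unpair.1 ≤ n / 7 := Nat.unpair_left_le _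
    have h₂ : (n / 7).unpair.2 ≤ n / 7 := Nat.unpair_right_le _
    rw [ofNat]
    have hn : n % 7 < 7 := Nat.mod_lt _ (by omega)
    generalize hm : n % 7 = m at hn
    interval_cases m
    · simp [g, hm, Fe]
    · simp [g, hm, Fl]
    · simp [g, hm, FA]
    · simp [g, hm, FB]
    · have h₃ : n / 7 < n := by omega
      simp [g, hm, Fc, h₃]
    · have h₃ : (n / 7).unpair.1 < n := by omega
      have h₄ : (n / 7).unpair.2 < n := by omega
      simp [g, hm, Fk, h₃, h₄]
    · have h₃ : (n / 7).unpair.1 < n := by omega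
      have h₄ : (n / 7).unpair.2 < n := by omega
      simp [g, hm, Fd, h₃, h₄]
  have := Primrec.nat_strong_rec (fun a n => F a (ofNat n)) hg H
  refine (this.comp Primrec.fst (primrec_toNat Primrec.snd)).of_eq fun p => ?_
  rw [ofNat_toNat]

end QFFormula

end

/-! ### Multiplicatively dependent bases -/

/-- The largest number `g` having both `α` and `β` among its positive powers. -/
def commonRoot (α β : ℕ) : ℕ :=
  Nat.findGreatest (fun g => (∃ i < α, g ^ (i + 1) = α) ∧ ∃ i < β, g ^ (i + 1) = β) α

theorem primrec_commonRoot : Primrec₂ commonRoot := by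
  have h : PrimrecRel fun (x : ℕ) (p : ℕ × ℕ) => p.2 ^ (x + 1) = p.1 :=
    Primrec.eq.comp (show Primrec fun q : ℕ × ℕ × ℕ => q.2.2 ^ (q.1 + 1) by fun_prop)
      (show Primrec fun q : ℕ × ℕ × ℕ => q.2.1 by fun_prop)
  have h' : PrimrecRel fun (n : ℕ) (p : ℕ × ℕ) => ∃ x < n, p.2 ^ (x + 1) = p.1 :=
    (h.exists_mem_list.comp (show Primrec fun q : ℕ × ℕ × ℕ => List.range q.1 by fun_prop)
      (show Primrec fun q : ℕ × ℕ × ℕ => q.2 by fun_prop)).of_eq fun q => by simp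
  have h1 : PrimrecPred fun q : (ℕ × ℕ) × ℕ => ∃ x < q.1.1, q.2 ^ (x + 1) = q.1.1 :=
    h'.comp (show Primrec fun q : (ℕ × ℕ) × ℕ => q.1.1 by fun_prop)
      (show Primrec fun q : (ℕ × ℕ) × ℕ => (q.1.1, q.2) by fun_prop)
  have h2 : PrimrecPred fun q : (ℕ × ℕ) × ℕ => ∃ x < q.1.2, q.2 ^ (x + 1) = q.1.2 :=
    h'.comp (show Primrec fun q : (ℕ × ℕ) × ℕ => q.1.2 by fun_prop)
      (show Primrec fun q : (ℕ × ℕ) × ℕ => (q.1.2, q.2) by fun_prop)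
  have h3 : PrimrecRel fun (p : ℕ × ℕ) (g : ℕ) =>
      (∃ i < p.1, g ^ (i + 1) = p.1) ∧ ∃ i < p.2, g ^ (i + 1) = p.2 := h1.and h2
  exact Primrec.nat_findGreatest (f := fun p : ℕ × ℕ => p.1) Primrec.fst h3

theorem commonRoot_spec {α β : ℕ} (hα : 1 < α) (hβ : 1 < β) (h : ¬ MultIndep α β) :
    1 < commonRoot α β ∧ (∃ a, 0 < a ∧ α = commonRoot α β ^ a) ∧
      ∃ b, 0 < b ∧ β = commonRoot α β ^ b := by
  obtain ⟨m, n, e, hmn⟩ : ∃ m n : ℕ, α ^ m = β ^ n ∧ ¬ (m = 0 ∧ n = 0) := by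
    simpa only [MultIndep, not_forall, exists_prop] using h
  obtain ⟨c, h1, h2⟩ := Nat.exists_eq_pow_of_pow_eq_pow (by omega) e
  generalize n / m.gcd n = k at h1
  generalize m / m.gcd n = l at h2
  have hk : k ≠ 0 := by rintro rfl; simp at h1; omega
  have hl : l ≠ 0 := by rintro rfl; simp at h2; omega
  have hc : 1 < c := by
    by_contra hc
    interval_cases c
    · simp [hk] at h1; omega
    · simp at h1; omega
  have hP : (∃ i < α, c ^ (i + 1) = α) ∧ ∃ i < β, c ^ (i + 1) = β := by
    refine ⟨⟨k - 1, ?_, ?_⟩, ⟨l - 1, ?_, ?_⟩⟩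
    · have := Nat.lt_pow_self hc (n := k); omega
    · rw [Nat.sub_add_cancel (by omega), h1]
    · have := Nat.lt_pow_self hc (n := l); omega
    · rw [Nat.sub_add_cancel (by omega), h2]
  have hcα : c ≤ α := h1 ▸ Nat.le_self_pow hk c
  have hle : c ≤ commonRoot α β := Nat.le_findGreatest hcα hP
  obtain ⟨⟨i, -, hi⟩, ⟨j, -, hj⟩⟩ := Nat.findGreatest_spec
    (P := fun g => (∃ i < α, g ^ (i + 1) = α) ∧ ∃ i < β, g ^ (i + 1) = β) hcα hP
  exact ⟨by omega, ⟨i + 1, by omega, hi.symm⟩, ⟨j + 1, by omega, hj.symm⟩⟩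

/-- The powers of `γ ^ a` are the powers of `γ` that are congruent to `1` modulo `γ ^ a - 1`. -/
theorem exists_eq_pow_pow_iff {γ a : ℕ} (hγ : 1 < γ) {x y r : ℤ}
    (hx : x = 1 + r + ((γ ^ a - 1 : ℕ) : ℤ) * y) (hr : 0 ≤ r) (hr' : r < ((γ ^ a - 1 : ℕ) : ℤ)) :
    (∃ n : ℕ, x = ((γ ^ a : ℕ) : ℤ) ^ n) ↔ (∃ n : ℕ, x = (γ : ℤ) ^ n) ∧ r = 0 := by
  have h1 : 1 ≤ γ ^ a := Nat.one_le_pow _ _ (by omega)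
  constructor
  · rintro ⟨n, hn⟩
    refine ⟨⟨a * n, by rw [hn, pow_mul]; push_cast; rfl⟩, ?_⟩
    have h2 : ((γ ^ a - 1 : ℕ) : ℤ) ∣ ((γ ^ a : ℕ) : ℤ) ^ n - 1 := by
      have := sub_dvd_pow_sub_pow ((γ ^ a : ℕ) : ℤ) 1 n
      rw [one_pow] at this
      rwa [Nat.cast_sub h1]
    have h3 : ((γ ^ a - 1 : ℕ) : ℤ) ∣ r := by
      have : r = (((γ ^ a : ℕ) : ℤ) ^ n - 1) - ((γ ^ a - 1 : ℕ) : ℤ) * y := by rw [← hn, hx]; ring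
      rw [this]
      exact dvd_sub h2 (dvd_mul_right _ _)
    exact Int.eq_zero_of_dvd_of_nonneg_of_lt hr hr' h3
  · rintro ⟨⟨n, hn⟩, rfl⟩
    have h2 : γ ^ a - 1 ∣ γ ^ n - 1 := by
      have h3 : 1 ≤ γ ^ n := Nat.one_le_pow _ _ (by omega)
      rw [← Int.natCast_dvd_natCast]
      refine ⟨y, ?_⟩
      rw [Nat.cast_sub h3, Nat.cast_pow, ← hn, hx]
      push_cast
      ring
    have h3 : γ ^ a.gcd n = γ ^ a := by
      have h4 := Nat.pow_sub_one_gcd_pow_sub_one γ a n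
      rw [Nat.gcd_eq_left h2] at h4
      have h5 : 1 ≤ γ ^ a.gcd n := Nat.one_le_pow _ _ (by omega)
      omega
    obtain ⟨k, rfl⟩ := Nat.gcd_eq_left_iff_dvd.1 (Nat.pow_right_injective hγ h3)
    exact ⟨k, by rw [hn, pow_mul]; push_cast; rfl⟩

namespace PATerm

/-- Renaming of the variable `xᵢ` to `x₅ᵢ`. -/
def spread : PATerm → PATerm
  | zero => zero
  | one => one
  | var i => var (5 * i)
  | add s t => add s.spread t.spread

/-- The term `t + ⋯ + t` with `n` summands. -/
def nsmul (n : ℕ) (t : PATerm) : PATerm := Nat.rec zero (fun _ s => add s t) n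

theorem eval_spread (v : ℕ → ℤ) (t : PATerm) :
    t.spread.eval v = t.eval fun i => v (5 * i) := by
  induction t with
  | zero => rfl
  | one => rfl
  | var i => rfl
  | add s t hs ht => simp only [spread, eval, hs, ht]

theorem eval_nsmul (v : ℕ → ℤ) (n : ℕ) (t : PATerm) : (nsmul n t).eval v = n * t.eval v := by
  induction n with
  | zero => simp [nsmul, eval]
  | succ n ih =>
    have : nsmul (n + 1) t = add (nsmul n t) t := rfl
    rw [this, eval, ih]
    push_cast
    ring

@[fun_prop] theorem primrec_spread {α : Type*} [Primcodable α] {f : α → PATerm}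
    (hf : Primrec f) : Primrec fun a => (f a).spread := by
  have h := primrec_rec (F := fun (_ : Unit) t => t.spread) (z := fun _ => zero)
    (o := fun _ => one) (v := fun _ i => var (5 * i)) (d := fun _ s t => add s t)
    (by fun_prop) (by fun_prop) (by fun_prop) (by fun_prop)
    (fun _ => rfl) (fun _ => rfl) (fun _ _ => rfl) (fun _ _ _ => rfl)
  exact h.comp (show Primrec fun a => ((), f a) by fun_prop)

@[fun_prop] theorem primrec_nsmul {α : Type*} [Primcodable α] {n : α → ℕ} {f : α → PATerm}
    (hn : Primrec n) (hf : Primrec f) : Primrec fun a => nsmul (n a) (f a) := by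
  unfold nsmul
  fun_prop

end PATerm

namespace QFFormula

/-- The formula `t = 1 + r + m y ∧ 0 ≤ r < m`, with `t` spread. -/
def divMod (m : ℕ) (t : PATerm) (y r : ℕ) : QFFormula :=
  and (eq t.spread (.add (.add .one (.var r)) (.nsmul m (.var y))))
    (and (not (lt (.var r) .zero)) (lt (.var r) (.nsmul m .one)))

/-- The conjunction of the definitions of quotient and remainder of `t - 1` modulo `α - 1`,
respectively `β - 1`, for all arguments `t` of the power predicates. -/
def remainderDefs (α β : ℕ) : QFFormula → QFFormula
  | eq _ _ => eq .zero .zero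
  | lt _ _ => eq .zero .zero
  | powA t => divMod (α - 1) t (5 * t.toNat + 1) (5 * t.toNat + 2)
  | powB t => divMod (β - 1) t (5 * t.toNat + 3) (5 * t.toNat + 4)
  | not φ => φ.remainderDefs α β
  | and φ ψ => and (φ.remainderDefs α β) (ψ.remainderDefs α β)
  | or φ ψ => and (φ.remainderDefs α β) (ψ.remainderDefs α β)

/-- Replacement of the power predicates by the powers of a common root with remainder zero. -/
def toCommonRoot : QFFormula → QFFormula
  | eq s t => eq s.spread t.spread
  | lt s t => lt s.spread t.spread
  | powA t => and (powA t.spread) (eq (.var (5 * t.toNat + 2)) .zero)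
  | powB t => and (powA t.spread) (eq (.var (5 * t.toNat + 4)) .zero)
  | not φ => not φ.toCommonRoot
  | and φ ψ => and φ.toCommonRoot ψ.toCommonRoot
  | or φ ψ => or φ.toCommonRoot ψ.toCommonRoot

theorem holds_divMod {γ δ : ℕ} {v : ℕ → ℤ} {m : ℕ} {t : PATerm} {y r : ℕ} :
    (divMod m t y r).Holds γ δ v ↔
      t.eval (fun i => v (5 * i)) = 1 + v r + m * v y ∧ 0 ≤ v r ∧ v r < m := by
  simp [divMod, Holds, PATerm.eval, PATerm.eval_nsmul, PATerm.eval_spread]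

theorem holds_toCommonRoot {γ a b : ℕ} (hγ : 1 < γ) {v : ℕ → ℤ}
    (φ : QFFormula) (h : (φ.remainderDefs (γ ^ a) (γ ^ b)).Holds γ γ v) :
    φ.toCommonRoot.Holds γ γ v ↔ φ.Holds (γ ^ a) (γ ^ b) fun i => v (5 * i) := by
  induction φ with
  | eq s t => simp [toCommonRoot, Holds, PATerm.eval_spread]
  | lt s t => simp [toCommonRoot, Holds, PATerm.eval_spread]
  | powA t =>
    obtain ⟨h1, h2, h3⟩ := holds_divMod.1 h
    simp only [toCommonRoot, Holds, PATerm.eval_spread, PATerm.eval]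
    exact (exists_eq_pow_pow_iff hγ h1 h2 h3).symm
  | powB t =>
    obtain ⟨h1, h2, h3⟩ := holds_divMod.1 h
    simp only [toCommonRoot, Holds, PATerm.eval_spread, PATerm.eval]
    exact (exists_eq_pow_pow_iff hγ h1 h2 h3).symm
  | not φ ih => simp only [toCommonRoot, Holds, ih h]
  | and φ ψ ih ih' => simp only [toCommonRoot, Holds, ih h.1, ih' h.2]
  | or φ ψ ih ih' => simp only [toCommonRoot, Holds, ih h.1, ih' h.2]

/-- Quotients and remainders added to an assignment. -/
def withRemainders (α β : ℕ) (v : ℕ → ℤ) (i : ℕ) : ℤ :=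
  let x := (PATerm.ofNat (i / 5)).eval v - 1
  if i % 5 = 0 then v (i / 5)
  else if i % 5 = 1 then x / ((α - 1 : ℕ) : ℤ)
  else if i % 5 = 2 then x % ((α - 1 : ℕ) : ℤ)
  else if i % 5 = 3 then x / ((β - 1 : ℕ) : ℤ)
  else x % ((β - 1 : ℕ) : ℤ)

theorem withRemainders_mul (α β : ℕ) (v : ℕ → ℤ) :
    (fun i => withRemainders α β v (5 * i)) = v := by
  funext i
  simp [withRemainders]

theorem holds_remainderDefs {α β : ℕ} (hα : 1 < α) (hβ : 1 < β) (γ : ℕ) (v : ℕ → ℤ)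
    (φ : QFFormula) : (φ.remainderDefs α β).Holds γ γ (withRemainders α β v) := by
  have d : ∀ n k : ℕ, k < 5 → (5 * n + k) / 5 = n ∧ (5 * n + k) % 5 = k := by omega
  have key : ∀ x m : ℤ, 0 < m → x = 1 + (x - 1) % m + m * ((x - 1) / m) ∧ 0 ≤ (x - 1) % m ∧
      (x - 1) % m < m := fun x m hm =>
    ⟨by have := Int.emod_add_mul_ediv (x - 1) m; linarith, Int.emod_nonneg _ hm.ne',
      Int.emod_lt_of_pos _ hm⟩
  induction φ with
  | eq s t => rfl
  | lt s t => rfl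
  | powA t =>
    refine holds_divMod.2 ?_
    rw [withRemainders_mul]
    simp only [withRemainders, d t.toNat 1 (by omega), d t.toNat 2 (by omega),
      PATerm.ofNat_toNat]
    exact key _ _ (by omega)
  | powB t =>
    refine holds_divMod.2 ?_
    rw [withRemainders_mul]
    simp only [withRemainders, d t.toNat 3 (by omega), d t.toNat 4 (by omega),
      PATerm.ofNat_toNat]
    exact key _ _ (by omega)
  | not φ ih => exact ih
  | and φ ψ ih ih' => exact ⟨ih, ih'⟩
  | or φ ψ ih ih' => exact ⟨ih, ih'⟩

@[fun_prop] theorem primrec_divMod {α : Type*} [Primcodable α] {m y r : α → ℕ} {t : α → PATerm}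
    (hm : Primrec m) (ht : Primrec t) (hy : Primrec y) (hr : Primrec r) :
    Primrec fun a => divMod (m a) (t a) (y a) (r a) := by
  unfold divMod
  fun_prop

theorem primrec_remainderDefs :
    Primrec fun p : (ℕ × ℕ) × QFFormula => p.2.remainderDefs p.1.1 p.1.2 :=
  primrec_rec (F := fun (p : ℕ × ℕ) φ => φ.remainderDefs p.1 p.2)
    (e := fun _ _ _ => eq .zero .zero) (l := fun _ _ _ => eq .zero .zero)
    (A := fun p t => divMod (p.1 - 1) t (5 * t.toNat + 1) (5 * t.toNat + 2))
    (B := fun p t => divMod (p.2 - 1) t (5 * t.toNat + 3) (5 * t.toNat + 4))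
    (c := fun _ φ => φ) (k := fun _ φ ψ => and φ ψ) (d := fun _ φ ψ => and φ ψ)
    (by fun_prop) (by fun_prop) (by fun_prop) (by fun_prop) (by fun_prop) (by fun_prop)
    (by fun_prop) (fun _ _ _ => rfl) (fun _ _ _ => rfl) (fun _ _ => rfl) (fun _ _ => rfl)
    (fun _ _ => rfl) (fun _ _ _ => rfl) (fun _ _ _ => rfl)

theorem primrec_toCommonRoot : Primrec toCommonRoot := by
  have h := primrec_rec (F := fun (_ : Unit) φ => φ.toCommonRoot)
    (e := fun _ s t => eq s.spread t.spread) (l := fun _ s t => lt s.spread t.spread)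
    (A := fun _ t => and (powA t.spread) (eq (.var (5 * t.toNat + 2)) .zero))
    (B := fun _ t => and (powA t.spread) (eq (.var (5 * t.toNat + 4)) .zero))
    (c := fun _ φ => not φ) (k := fun _ φ ψ => and φ ψ) (d := fun _ φ ψ => or φ ψ)
    (by fun_prop) (by fun_prop) (by fun_prop) (by fun_prop) (by fun_prop) (by fun_prop)
    (by fun_prop) (fun _ _ _ => rfl) (fun _ _ _ => rfl) (fun _ _ => rfl) (fun _ _ => rfl)
    (fun _ _ => rfl) (fun _ _ _ => rfl) (fun _ _ _ => rfl)
  exact h.comp (show Primrec fun φ : QFFormula => ((), φ) by fun_prop)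

theorem mem_existentialPAOne_iff {γ a b : ℕ} (hγ : 1 < γ) (ha : 0 < a) (hb : 0 < b)
    (φ : QFFormula) :
    φ ∈ ExistentialPA (γ ^ a) (γ ^ b) ↔
      and (φ.remainderDefs (γ ^ a) (γ ^ b)) φ.toCommonRoot ∈ ExistentialPAOne γ := by
  constructor
  · rintro ⟨v, hv⟩
    have h := holds_remainderDefs (Nat.one_lt_pow ha.ne' hγ) (Nat.one_lt_pow hb.ne' hγ) γ v φ
    refine ⟨withRemainders (γ ^ a) (γ ^ b) v, h, ?_⟩
    rw [holds_toCommonRoot hγ φ h, withRemainders_mul]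
    exact hv
  · rintro ⟨v, h, hv⟩
    exact ⟨_, (holds_toCommonRoot hγ φ h).1 hv⟩

end QFFormula

theorem exists_reduction_to_common_root :
    ∃ γ : ℕ → ℕ → ℕ, Computable₂ γ ∧
      ∃ f : ℕ × ℕ × QFFormula → QFFormula, Computable f ∧
        ∀ α β : ℕ, 1 < α → 1 < β → ¬ MultIndep α β →
          1 < γ α β ∧
          ∀ φ : QFFormula,
            φ ∈ ExistentialPA α β ↔ f (α, β, φ) ∈ ExistentialPAOne (γ α β) := by
  refine ⟨commonRoot, primrec_commonRoot.to_comp,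
    fun p => .and (p.2.2.remainderDefs p.1 p.2.1) p.2.2.toCommonRoot, Primrec.to_comp ?_, ?_⟩
  · have h1 := QFFormula.primrec_remainderDefs.comp
      (show Primrec fun p : ℕ × ℕ × QFFormula => ((p.1, p.2.1), p.2.2) by fun_prop)
    have h2 := QFFormula.primrec_toCommonRoot.comp
      (show Primrec fun p : ℕ × ℕ × QFFormula => p.2.2 by fun_prop)
    exact QFFormula.primrec_and h1 h2
  · intro α β hα hβ h
    obtain ⟨hγ, ⟨a, ha, hαa⟩, ⟨b, hb, hβb⟩⟩ := commonRoot_spec hα hβ h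
    refine ⟨hγ, fun φ => ?_⟩
    have := QFFormula.mem_existentialPAOne_iff hγ ha hb φ
    rwa [← hαa, ← hβb] at this

/-! ### Integer solutions of bounded height for systems of linear inequalities -/

/-- `u` is an affine combination of `z₀, …, z_{J-1}` with coefficients of size at most `k`; the
coefficient `q J` is the constant term. -/
def HasHeight (z : ℕ → ℤ) (J k : ℕ) (u : ℤ) : Prop :=
  ∃ q : ℕ → ℤ, (∀ j, (q j).natAbs ≤ k) ∧ u = ∑ j ∈ Finset.range J, q j * z j + q J

namespace HasHeight

variable {z : ℕ → ℤ} {J k l : ℕ} {u w : ℤ}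

theorem mono (h : HasHeight z J k u) (hkl : k ≤ l) : HasHeight z J l u :=
  let ⟨q, hq, e⟩ := h
  ⟨q, fun j => (hq j).trans hkl, e⟩

theorem add (h : HasHeight z J k u) (h' : HasHeight z J l w) : HasHeight z J (k + l) (u + w) := by
  obtain ⟨q, hq, rfl⟩ := h
  obtain ⟨r, hr, rfl⟩ := h'
  refine ⟨fun j => q j + r j, fun j =>
    (Int.natAbs_add_le _ _).trans (Nat.add_le_add (hq j) (hr j)), ?_⟩
  simp only [add_mul, Finset.sum_add_distrib]
  ring

theorem mul (c : ℤ) (h : HasHeight z J k u) : HasHeight z J (c.natAbs * k) (c * u) := by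
  obtain ⟨q, hq, rfl⟩ := h
  refine ⟨fun j => c * q j, fun j => ?_, ?_⟩
  · rw [Int.natAbs_mul]
    exact Nat.mul_le_mul_left _ (hq j)
  · simp only [mul_assoc, mul_add, Finset.mul_sum]

theorem int (z : ℕ → ℤ) (J : ℕ) (c : ℤ) : HasHeight z J c.natAbs c := by
  refine ⟨fun j => if j = J then c else 0, fun j => ?_, ?_⟩
  · dsimp only
    split_ifs <;> simp
  · rw [Finset.sum_eq_zero]
    · simp
    · intro j hj
      dsimp only
      rw [if_neg (Finset.mem_range.1 hj).ne, zero_mul]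

theorem sub (h : HasHeight z J k u) (h' : HasHeight z J l w) : HasHeight z J (k + l) (u - w) := by
  have := h.add (h'.mul (-1))
  simpa [sub_eq_add_neg] using this

theorem sum {n : ℕ} {f : ℕ → ℤ} (h : ∀ i < n, HasHeight z J k (f i)) :
    HasHeight z J (n * k) (∑ i ∈ Finset.range n, f i) := by
  induction n with
  | zero => simpa using HasHeight.int z J 0
  | succ n ih =>
    rw [Finset.sum_range_succ, Nat.succ_mul]
    exact (ih fun i hi => h i (by omega)).add (h n (by omega))

theorem coord {j : ℕ} (hj : j < J) : HasHeight z J 1 (z j) := by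
  refine ⟨fun i => if i = j then 1 else 0, fun i => ?_, ?_⟩
  · dsimp only
    split_ifs <;> simp
  · rw [Finset.sum_eq_single j]
    · simp [hj.ne']
    · intro i _ hi
      simp [hi]
    · intro h
      exact absurd (Finset.mem_range.2 hj) h

end HasHeight

/-- A common denominator and a height bound for solutions in `m` unknowns of systems with
coefficients of size at most `C`, in a prescribed residue class modulo `D`. -/
def heightBound : ℕ → ℕ → ℕ → ℕ × ℕ
  | 0, _, _ => (1, 0)
  | m + 1, C, D =>
    let p := heightBound m (3 * C * C * D) (D * C.factorial)
    (p.1 * C.factorial,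
      C.factorial * (p.1 * (C * D + C) + m * (C * p.2) + p.2) + p.1 * C.factorial * D)

theorem heightBound_fst_pos (m C D : ℕ) : 0 < (heightBound m C D).1 := by
  induction m generalizing C D with
  | zero => exact Nat.one_pos
  | succ m ih => exact Nat.mul_pos (ih _ _) (Nat.factorial_pos _)

theorem sum_update_of_ge {m n : ℕ} (h : m ≤ n) (a y : ℕ → ℤ) (t : ℤ) :
    ∑ i ∈ Finset.range m, a i * Function.update y n t i = ∑ i ∈ Finset.range m, a i * y i := by
  refine Finset.sum_congr rfl fun i hi => ?_
  have := Finset.mem_range.1 hi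
  rw [Function.update_of_ne (by omega)]

/-- A predicate holding at `0` but not everywhere fails right after some point where it holds. -/
theorem exists_and_not_succ {P : ℕ → Prop} (h : P 0) {n : ℕ} (hn : ¬ P n) :
    ∃ k, P k ∧ ¬ P (k + 1) := by
  by_contra! H
  exact hn (Nat.rec h (fun k hk => H k hk) n)

/-- Elimination of one unknown: after replacing its value, some inequality is tight up to a bounded
error. -/
theorem exists_tight {m D : ℕ} (hD : 0 < D) {S : Set ((ℕ → ℤ) × ℤ)} {x : ℕ → ℤ}
    (hx : ∀ f ∈ S, 0 ≤ ∑ i ∈ Finset.range (m + 1), f.1 i * x i + f.2)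
    {f₀ : (ℕ → ℤ) × ℤ} (hf₀ : f₀ ∈ S) (h₀ : f₀.1 m ≠ 0) :
    ∃ t s : ℤ, (D : ℤ) ∣ t - x m ∧ s * s = 1 ∧
      (∀ f ∈ S, 0 ≤ ∑ i ∈ Finset.range m, f.1 i * x i + f.1 m * t + f.2) ∧
      ∃ f ∈ S, 0 < s * f.1 m ∧
        ∑ i ∈ Finset.range m, f.1 i * x i + f.1 m * t + f.2 < s * f.1 m * D := by
  obtain ⟨s, hs, hs0⟩ : ∃ s : ℤ, s * s = 1 ∧ 0 < s * f₀.1 m := by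
    rcases lt_or_gt_of_ne h₀ with h | h
    · exact ⟨-1, by norm_num, by omega⟩
    · exact ⟨1, by norm_num, by omega⟩
  have hD' : (0 : ℤ) < D := by exact_mod_cast hD
  let P : ℕ → Prop := fun k => ∀ f ∈ S,
    0 ≤ ∑ i ∈ Finset.range m, f.1 i * x i + f.1 m * (x m - s * D * k) + f.2
  have hP0 : P 0 := fun f hf => by
    have := hx f hf
    rw [Finset.sum_range_succ] at this
    simpa using this
  set c := ∑ i ∈ Finset.range m, f₀.1 i * x i + f₀.1 m * x m + f₀.2 with hc
  have hPn : ¬ P (c.toNat + 1) := fun h => by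
    have h1 := h f₀ hf₀
    have h2 : ∑ i ∈ Finset.range m, f₀.1 i * x i +
        f₀.1 m * (x m - s * D * ((c.toNat + 1 : ℕ) : ℤ)) + f₀.2
        = c - s * f₀.1 m * D * (c.toNat + 1) := by rw [hc]; push_cast; ring
    rw [h2] at h1
    have h3 : 1 ≤ s * f₀.1 m * D := Int.add_one_le_iff.2 (mul_pos hs0 hD')
    have h4 : (c.toNat + 1 : ℤ) ≤ s * f₀.1 m * D * (c.toNat + 1) :=
      le_mul_of_one_le_left (by positivity) h3
    omega
  obtain ⟨k, hk, hk'⟩ := exists_and_not_succ hP0 hPn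
  obtain ⟨f, hf, hlt⟩ : ∃ f ∈ S, ∑ i ∈ Finset.range m, f.1 i * x i +
      f.1 m * (x m - s * D * ((k + 1 : ℕ) : ℤ)) + f.2 < 0 := by
    simpa only [P, not_forall, exists_prop, not_le] using hk'
  have h1 := hk f hf
  have h2 : ∑ i ∈ Finset.range m, f.1 i * x i + f.1 m * (x m - s * D * ((k + 1 : ℕ) : ℤ)) + f.2
      = ∑ i ∈ Finset.range m, f.1 i * x i + f.1 m * (x m - s * D * k) + f.2
        - s * f.1 m * D := by push_cast; ring
  rw [h2] at hlt
  refine ⟨x m - s * D * k, s, ⟨-(s * k), by ring⟩, hs, hk, f, hf, ?_, by linarith⟩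
  have h3 : 0 < s * f.1 m * D := by linarith
  exact pos_of_mul_pos_left h3 hD'.le

/-- If a system of linear inequalities with bounded integer coefficients in the unknowns and
bounded heights of the constant terms has an integer solution, then it has a solution in the same
residue class, the coordinates of which have bounded height up to a common denominator. -/
theorem exists_solution_hasHeight (z : ℕ → ℤ) (J m C D : ℕ) (hD : 0 < D)
    (S : Set ((ℕ → ℤ) × ℤ))
    (hS : ∀ f ∈ S, (∀ i < m, (f.1 i).natAbs ≤ C) ∧ HasHeight z J C f.2) (x : ℕ → ℤ)
    (hx : ∀ f ∈ S, 0 ≤ ∑ i ∈ Finset.range m, f.1 i * x i + f.2) :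
    ∃ y : ℕ → ℤ, (∀ i < m, (D : ℤ) ∣ y i - x i) ∧
      (∀ f ∈ S, 0 ≤ ∑ i ∈ Finset.range m, f.1 i * y i + f.2) ∧
      ∀ i < m, HasHeight z J (heightBound m C D).2 ((heightBound m C D).1 * y i) := by
  induction m generalizing C D S with
  | zero => exact ⟨x, by simp, hx, by simp⟩
  | succ m ih =>
    set C' := 3 * C * C * D with hC'
    set D' := D * C.factorial with hD'
    have hD'pos : 0 < D' := Nat.mul_pos hD (Nat.factorial_pos _)
    set Δ := (heightBound m C' D').1 with hΔ
    set H := (heightBound m C' D').2 with hH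
    have e1 : (heightBound (m + 1) C D).1 = Δ * C.factorial := rfl
    have e2 : (heightBound (m + 1) C D).2 = C.factorial * (Δ * (C * D + C) + m * (C * H) + H)
      + Δ * C.factorial * D := rfl
    have hCC : C * C ≤ C * C * D := Nat.le_mul_of_pos_right _ hD
    have hold : ∀ y : ℤ, HasHeight z J H (Δ * y) →
        HasHeight z J (heightBound (m + 1) C D).2 ((heightBound (m + 1) C D).1 * y) := by
      intro y hy
      have := hy.mul (C.factorial : ℤ)
      rw [e1, e2]
      have e3 : ((Δ * C.factorial : ℕ) : ℤ) * y = (C.factorial : ℤ) * (Δ * y) := by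
        push_cast; ring
      rw [e3]
      refine this.mono ?_
      rw [Int.natAbs_natCast]
      refine le_add_right ?_
      exact Nat.mul_le_mul_left _ (Nat.le_add_left _ _)
    by_cases h0 : ∃ f ∈ S, f.1 m ≠ 0
    · obtain ⟨f₀, hf₀, h₀⟩ := h0
      obtain ⟨t, s, htx, hs, ht, f₁, hf₁, hpos, hlt⟩ := exists_tight hD hx hf₀ h₀
      set c := ∑ i ∈ Finset.range m, f₁.1 i * x i + f₁.1 m * t + f₁.2 with hc
      set e := s * f₁.1 m with he
      have hs1 : s.natAbs = 1 := by
        rcases mul_self_eq_one_iff.1 hs with rfl | rfl <;> rfl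
      have heC : e.natAbs ≤ C := by
        rw [he, Int.natAbs_mul, hs1, one_mul]
        exact (hS f₁ hf₁).1 m (Nat.lt_succ_self m)
      have hc0 : 0 ≤ c := ht f₁ hf₁
      have hcC : c.natAbs ≤ C * D := by
        have h1 : (e.natAbs : ℤ) = e := Int.natAbs_of_nonneg hpos.le
        have h2 : (c.natAbs : ℤ) = c := Int.natAbs_of_nonneg hc0
        have h3 : (c.natAbs : ℤ) ≤ (e.natAbs * D : ℕ) := by
          rw [Nat.cast_mul, h1, h2]
          exact hlt.le
        exact (Int.ofNat_le.1 h3).trans (Nat.mul_le_mul_right _ heC)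
      have hcp : HasHeight z J (C * D + C) (c - f₁.2) :=
        ((HasHeight.int z J c).mono hcC).sub (hS f₁ hf₁).2
      let g : (ℕ → ℤ) × ℤ → (ℕ → ℤ) × ℤ := fun f =>
        (fun i => e * f.1 i - s * f.1 m * f₁.1 i, e * f.2 + s * f.1 m * (c - f₁.2))
      have hg : ∀ (f : (ℕ → ℤ) × ℤ) (y : ℕ → ℤ) (r : ℤ),
          ∑ i ∈ Finset.range m, f₁.1 i * y i + f₁.1 m * r + f₁.2 = c →
          ∑ i ∈ Finset.range m, (g f).1 i * y i + (g f).2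
            = e * (∑ i ∈ Finset.range m, f.1 i * y i + f.1 m * r + f.2) := by
        intro f y r hr
        have h1 : ∑ i ∈ Finset.range m, (g f).1 i * y i
            = e * ∑ i ∈ Finset.range m, f.1 i * y i
              - s * f.1 m * ∑ i ∈ Finset.range m, f₁.1 i * y i := by
          rw [Finset.mul_sum, Finset.mul_sum, ← Finset.sum_sub_distrib]
          exact Finset.sum_congr rfl fun i _ => by simp only [g]; ring
        rw [h1]
        simp only [g]
        rw [← hr]
        linear_combination (-(f.1 m * r)) * he
      have hgS : ∀ f ∈ g '' S, (∀ i < m, (f.1 i).natAbs ≤ C') ∧ HasHeight z J C' f.2 := by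
        rintro _ ⟨f, hf, rfl⟩
        have hsf : (s * f.1 m).natAbs ≤ C := by
          rw [Int.natAbs_mul, hs1, one_mul]
          exact (hS f hf).1 m (Nat.lt_succ_self m)
        constructor
        · intro i hi
          have h1 : (e * f.1 i).natAbs ≤ C * C := by
            rw [Int.natAbs_mul]
            exact Nat.mul_le_mul heC ((hS f hf).1 i (by omega))
          have h2 : (s * f.1 m * f₁.1 i).natAbs ≤ C * C := by
            rw [Int.natAbs_mul]
            exact Nat.mul_le_mul hsf ((hS f₁ hf₁).1 i (by omega))
          have h3 : (e * f.1 i - s * f.1 m * f₁.1 i).natAbs ≤ C * C + C * C :=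
            (Int.natAbs_sub_le _ _).trans (Nat.add_le_add h1 h2)
          have h4 : C' = 3 * (C * C * D) := by rw [hC']; ring
          simp only [g]
          omega
        · have h1 : HasHeight z J (C * C) (e * f.2) :=
            ((hS f hf).2.mul e).mono (Nat.mul_le_mul_right _ heC)
          have h2 : HasHeight z J (C * (C * D + C)) (s * f.1 m * (c - f₁.2)) :=
            (hcp.mul _).mono (Nat.mul_le_mul_right _ hsf)
          refine (h1.add h2).mono ?_
          have h4 : C' = 3 * (C * C * D) := by rw [hC']; ring
          have h5 : C * (C * D + C) = C * C * D + C * C := by ring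
          omega
      have hgx : ∀ f ∈ g '' S, 0 ≤ ∑ i ∈ Finset.range m, f.1 i * x i + f.2 := by
        rintro _ ⟨f, hf, rfl⟩
        rw [hg f x t rfl]
        exact mul_nonneg hpos.le (ht f hf)
      obtain ⟨y, hy1, hy2, hy3⟩ := ih C' D' hD'pos (g '' S) hgS hgx
      obtain ⟨b, hb⟩ : (D' : ℤ) ∣ ∑ i ∈ Finset.range m, f₁.1 i * (y i - x i) :=
        Finset.dvd_sum fun i hi => (hy1 i (Finset.mem_range.1 hi)).mul_left _
      obtain ⟨w, hw⟩ : e.natAbs ∣ C.factorial :=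
        Nat.dvd_factorial (Int.natAbs_pos.2 hpos.ne') heC
      have hwe : (C.factorial : ℤ) = e * w := by
        rw [hw]
        push_cast
        rw [abs_of_pos hpos]
      have hwC : w ≤ C.factorial := Nat.le_of_dvd (Nat.factorial_pos _) ⟨e.natAbs, by rw [hw, mul_comm]⟩
      have hsum : ∑ i ∈ Finset.range m, f₁.1 i * (y i - x i)
          = ∑ i ∈ Finset.range m, f₁.1 i * y i - ∑ i ∈ Finset.range m, f₁.1 i * x i := by
        rw [← Finset.sum_sub_distrib]
        exact Finset.sum_congr rfl fun i _ => by ring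
      set r := t - s * D * w * b with hr
      have hrc : ∑ i ∈ Finset.range m, f₁.1 i * y i + f₁.1 m * r + f₁.2 = c := by
        have h1 : f₁.1 m * (s * D * w * b) = D' * b := by
          rw [hD']
          push_cast
          rw [hwe, he]
          ring
        rw [hr, mul_sub, h1, ← hb, hsum, hc]
        ring
      refine ⟨Function.update y m r, fun i hi => ?_, fun f hf => ?_, fun i hi => ?_⟩
      · rcases Nat.lt_succ_iff_lt_or_eq.1 hi with hi | rfl
        · rw [Function.update_of_ne hi.ne]
          refine dvd_trans ?_ (hy1 i hi)
          rw [hD']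
          push_cast
          exact dvd_mul_right _ _
        · rw [Function.update_self, hr]
          have : t - s * D * w * b - x i = (t - x i) - D * (s * w * b) := by ring
          rw [this]
          exact dvd_sub htx (dvd_mul_right _ _)
      · rw [Finset.sum_range_succ, sum_update_of_ge le_rfl, Function.update_self]
        have := hy2 (g f) ⟨f, hf, rfl⟩
        rw [hg f y r hrc] at this
        exact nonneg_of_mul_nonneg_right this hpos
      · rcases Nat.lt_succ_iff_lt_or_eq.1 hi with hi | rfl
        · rw [Function.update_of_ne hi.ne]
          exact hold _ (hy3 i hi)
        · rw [Function.update_self, e1, e2]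
          have h1 : HasHeight z J (i * (C * H)) (∑ k ∈ Finset.range i, f₁.1 k * (Δ * y k)) :=
            HasHeight.sum fun k hk => ((hy3 k hk).mul (f₁.1 k)).mono
              (Nat.mul_le_mul_right _ ((hS f₁ hf₁).1 k (by omega)))
          have h2 : HasHeight z J (w * (Δ * (C * D + C) + i * (C * H)))
              (s * w * (Δ * (c - f₁.2) - ∑ k ∈ Finset.range i, f₁.1 k * (Δ * y k))) := by
            have := ((hcp.mul (Δ : ℤ)).sub h1).mul (s * w)
            rwa [Int.natAbs_mul, hs1, one_mul, Int.natAbs_natCast, Int.natAbs_natCast] at this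
          have h3 : ((Δ * C.factorial : ℕ) : ℤ) * r
              = s * w * (Δ * (c - f₁.2) - ∑ k ∈ Finset.range i, f₁.1 k * (Δ * y k)) := by
            have h4 : ∑ k ∈ Finset.range i, f₁.1 k * (Δ * y k)
                = Δ * ∑ k ∈ Finset.range i, f₁.1 k * y k := by
              rw [Finset.mul_sum]
              exact Finset.sum_congr rfl fun k _ => by ring
            rw [h4]
            push_cast
            rw [hwe, ← hrc, he]
            ring
          rw [h3]
          refine h2.mono ((Nat.mul_le_mul_right _ hwC).trans ?_)
          refine le_add_right (Nat.mul_le_mul_left _ (Nat.le_add_right _ _))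
    · push Not at h0
      have hCC' : C ≤ C' := by
        have h4 : C' = 3 * (C * C * D) := by rw [hC']; ring
        have h5 : C ≤ C * C := Nat.le_mul_self C
        omega
      have hx' : ∀ f ∈ S, 0 ≤ ∑ i ∈ Finset.range m, f.1 i * x i + f.2 := fun f hf => by
        have := hx f hf
        rwa [Finset.sum_range_succ, h0 f hf, zero_mul, add_zero] at this
      obtain ⟨y, hy1, hy2, hy3⟩ := ih C' D' hD'pos S (fun f hf =>
        ⟨fun i hi => ((hS f hf).1 i (by omega)).trans hCC', (hS f hf).2.mono hCC'⟩) hx'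
      refine ⟨Function.update y m (x m % D), fun i hi => ?_, fun f hf => ?_, fun i hi => ?_⟩
      · rcases Nat.lt_succ_iff_lt_or_eq.1 hi with hi | rfl
        · rw [Function.update_of_ne hi.ne]
          refine dvd_trans ?_ (hy1 i hi)
          rw [hD']
          push_cast
          exact dvd_mul_right _ _
        · rw [Function.update_self]
          refine ⟨-(x i / D), ?_⟩
          have := Int.emod_add_mul_ediv (x i) D
          linarith
      · rw [Finset.sum_range_succ, sum_update_of_ge le_rfl, h0 f hf, zero_mul, add_zero]
        exact hy2 f hf
      · rcases Nat.lt_succ_iff_lt_or_eq.1 hi with hi | rfl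
        · rw [Function.update_of_ne hi.ne]
          exact hold _ (hy3 i hi)
        · rw [Function.update_self, e1, e2]
          have hD0 : (0 : ℤ) < D := by exact_mod_cast hD
          have h1 := Int.emod_nonneg (x i) hD0.ne'
          have h2 := Int.emod_lt_of_pos (x i) hD0
          have h3 := (HasHeight.int z J (x i % D)).mul ((Δ * C.factorial : ℕ) : ℤ)
          refine h3.mono ?_
          rw [Int.natAbs_natCast]
          refine le_add_left (Nat.mul_le_mul_left _ ?_)
          omega

theorem heightBound_eq_foldr (m C D : ℕ) :
    (m, heightBound m C D) =
      ((List.range m).map fun k => (fun p : ℕ × ℕ => (3 * p.1 * p.1 * p.2,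
        p.2 * p.1.factorial))^[k] (C, D)).foldr
        (fun (p : ℕ × ℕ) (a : ℕ × ℕ × ℕ) => (a.1 + 1, a.2.1 * p.1.factorial,
          p.1.factorial * (a.2.1 * (p.1 * p.2 + p.1) + a.1 * (p.1 * a.2.2) + a.2.2)
            + a.2.1 * p.1.factorial * p.2)) (0, 1, 0) := by
  induction m generalizing C D with
  | zero => rfl
  | succ m ih =>
    rw [List.range_succ_eq_map, List.map_cons, List.map_map, List.foldr_cons]
    simp only [Function.comp_def, Function.iterate_succ_apply]
    rw [← ih]
    rfl

@[fun_prop] theorem primrec_heightBound {α : Type*} [Primcodable α] {m C D : α → ℕ}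
    (hm : Primrec m) (hC : Primrec C) (hD : Primrec D) :
    Primrec fun a => heightBound (m a) (C a) (D a) := by
  have h : Primrec fun a => (m a, heightBound (m a) (C a) (D a)) := by
    simp only [heightBound_eq_foldr]
    fun_prop
  exact Primrec.snd.comp h

/-! ### Linear constraints with power variables -/

namespace PATerm

/-- The value of a term with `1` interpreted as `o` and `xᵢ` as `q i`. -/
def lin (o : ℤ) (q : ℕ → ℤ) : PATerm → ℤ
  | zero => 0
  | one => o
  | var i => q i
  | add s t => s.lin o q + t.lin o q

@[fun_prop] theorem primrec_lin {α : Type*} [Primcodable α] {o : α → ℤ} {q : α → ℕ → ℤ}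
    {t : α → PATerm} (ho : Primrec o) (hq : Primrec fun p : α × ℕ => q p.1 p.2)
    (ht : Primrec t) : Primrec fun a => (t a).lin (o a) (q a) := by
  have h := primrec_rec (F := fun a t => t.lin (o a) (q a)) (z := fun _ => 0) (o := o)
    (v := q) (d := fun _ x y => x + y) (by fun_prop) ho hq (by fun_prop)
    (fun _ => rfl) (fun _ => rfl) (fun _ _ => rfl) (fun _ _ _ => rfl)
  exact h.comp (show Primrec fun a => (a, t a) by fun_prop)

theorem mul_eval_eq_sum_lin {x : ℕ → ℤ} {Δ : ℤ} {s : Finset ℕ} {o : ℕ → ℤ} {q : ℕ → ℕ → ℤ}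
    {w : ℕ → ℤ} {N : ℕ} (ho : Δ = ∑ j ∈ s, o j * w j)
    (hq : ∀ i ≤ N, Δ * x i = ∑ j ∈ s, q i j * w j) (t : PATerm) (ht : t.toNat ≤ N) :
    Δ * t.eval x = ∑ j ∈ s, t.lin (o j) (fun i => q i j) * w j := by
  induction t with
  | zero => simp [eval, lin]
  | one => simpa [eval, lin] using ho
  | var i =>
    simp only [toNat] at ht
    exact hq i (by omega)
  | add s t hs ht' =>
    simp only [toNat] at ht
    have h := Nat.add_le_pair s.toNat t.toNat
    simp only [eval, lin, add_mul, Finset.sum_add_distrib, mul_add]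
    rw [hs (by omega), ht' (by omega)]

/-- The coefficient of `xᵢ` in a term. -/
def coeff (i : ℕ) (t : PATerm) : ℤ := t.lin 0 fun k => if k = i then 1 else 0

/-- The constant term of a term. -/
def const (t : PATerm) : ℤ := t.lin 1 fun _ => 0

theorem lin_nonneg_le {o : ℤ} {q : ℕ → ℤ} (ho : 0 ≤ o ∧ o ≤ 1) (hq : ∀ i, 0 ≤ q i ∧ q i ≤ 1)
    (t : PATerm) : 0 ≤ t.lin o q ∧ t.lin o q ≤ t.toNat := by
  induction t with
  | zero => simp [lin, toNat]
  | one => simpa [lin, toNat] using ho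
  | var i =>
    have := hq i
    simp only [lin, toNat]
    push_cast
    omega
  | add s t hs ht =>
    have h := Nat.add_le_pair s.toNat t.toNat
    simp only [lin, toNat]
    push_cast
    omega

theorem natAbs_coeff_le (i : ℕ) (t : PATerm) : (t.coeff i).natAbs ≤ t.toNat := by
  have := lin_nonneg_le (o := 0) (q := fun k => if k = i then 1 else 0) (by omega)
    (fun k => by split_ifs <;> omega) t
  unfold coeff
  omega

theorem natAbs_const_le (t : PATerm) : t.const.natAbs ≤ t.toNat := by
  have := lin_nonneg_le (o := 1) (q := fun _ => 0) (by omega) (fun k => by omega) t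
  unfold const
  omega

theorem eval_eq_sum_coeff (x : ℕ → ℤ) {N : ℕ} (t : PATerm) (ht : t.toNat ≤ N) :
    t.eval x = ∑ i ∈ Finset.range (N + 1), t.coeff i * x i + t.const := by
  induction t with
  | zero => simp [eval, coeff, const, lin]
  | one => simp [eval, coeff, const, lin]
  | var i =>
    simp only [toNat] at ht
    simp only [eval, coeff, const, lin]
    rw [Finset.sum_eq_single i]
    · simp
    · intro j _ hj
      simp [hj.symm]
    · intro h
      exact absurd (Finset.mem_range.2 (by omega)) h
  | add s t hs ht' =>
    simp only [toNat] at ht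
    have h := Nat.add_le_pair s.toNat t.toNat
    have e1 : ∀ i, (add s t).coeff i = s.coeff i + t.coeff i := fun _ => rfl
    have e2 : (add s t).const = s.const + t.const := rfl
    simp only [eval, e1, e2, add_mul, Finset.sum_add_distrib]
    rw [hs (by omega), ht' (by omega)]
    ring

end PATerm

/-- The data `(s, t, u, v, a, k, i)` of the inequality `u s + v t + a zᵢ + k ≥ 0`. -/
abbrev TermIneq := PATerm × PATerm × ℤ × ℤ × ℤ × ℤ × ℕ

/-- The left side of the inequality `u s + v t + a zᵢ + k ≥ 0`. -/
def TermIneq.val (x z : ℕ → ℤ) : TermIneq → ℤ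
  | (s, t, u, v, a, k, i) => u * s.eval x + v * t.eval x + a * z i + k

/-- Case distinction for the comparison of `s` and `t`. -/
def compareCases (d : ℕ) (s t : PATerm) : List TermIneq :=
  bif d == 0 then [(s, t, 1, -1, 0, 0, 0), (s, t, -1, 1, 0, 0, 0)]
  else bif d == 1 then [(s, t, -1, 1, 0, -1, 0)]
  else [(s, t, 1, -1, 0, -1, 0)]

/-- Case distinction for the position of `t` relative to the power `zᵢ` of `α`: the cases are
`t = zᵢ`, `t ≤ 0` and `zᵢ < t < α zᵢ`. -/
def powerCases (α d : ℕ) (t : PATerm) (i : ℕ) : List TermIneq :=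
  bif d == 0 then [(t, t, 1, 0, -1, 0, i), (t, t, -1, 0, 1, 0, i)]
  else bif d == 1 then [(t, t, -1, 0, 0, 0, i)]
  else [(t, t, 1, 0, -1, -1, i), (t, t, -1, 0, α, -1, i)]

/-- The base of the power variable `z_j`. -/
def zBase (α β j : ℕ) : ℕ := bif j % 2 == 0 then α else β

theorem zBase_even (α β k : ℕ) : zBase α β (2 * k) = α := by simp [zBase]

theorem zBase_odd (α β k : ℕ) : zBase α β (2 * k + 1) = β := by
  have : (2 * k + 1) % 2 = 1 := by omega
  simp [zBase, this]

theorem one_lt_zBase {α β : ℕ} (hα : 1 < α) (hβ : 1 < β) (j : ℕ) : 1 < zBase α β j := by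
  unfold zBase
  cases j % 2 == 0
  · exact hβ
  · exact hα

namespace QFFormula

/-- The inequalities describing the cases `σ` of the atoms of a formula. -/
def caseIneqs (α β : ℕ) (σ : ℕ → ℕ) : QFFormula → List TermIneq
  | eq s t => compareCases (σ (eq s t).toNat) s t
  | lt s t => compareCases (σ (lt s t).toNat) s t
  | powA t => powerCases α (σ (powA t).toNat) t (2 * t.toNat)
  | powB t => powerCases β (σ (powB t).toNat) t (2 * t.toNat + 1)
  | not φ => φ.caseIneqs α β σ
  | and φ ψ => φ.caseIneqs α β σ ++ ψ.caseIneqs α β σ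
  | or φ ψ => φ.caseIneqs α β σ ++ ψ.caseIneqs α β σ

/-- The truth value of a formula in the cases `σ`. -/
def truth (σ : ℕ → ℕ) : QFFormula → Bool
  | eq s t => σ (eq s t).toNat == 0
  | lt s t => σ (lt s t).toNat == 1
  | powA t => σ (powA t).toNat == 0
  | powB t => σ (powB t).toNat == 0
  | not φ => !φ.truth σ
  | and φ ψ => φ.truth σ && ψ.truth σ
  | or φ ψ => φ.truth σ || ψ.truth σ

@[fun_prop] theorem primrec_truth {α : Type*} [Primcodable α] {σ : α → ℕ → ℕ}
    {φ : α → QFFormula} (hσ : Primrec fun p : α × ℕ => σ p.1 p.2) (hφ : Primrec φ) :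
    Primrec fun a => (φ a).truth (σ a) := by
  have h := primrec_rec (F := fun a φ => φ.truth (σ a))
    (e := fun a s t => σ a (eq s t).toNat == 0) (l := fun a s t => σ a (lt s t).toNat == 1)
    (A := fun a t => σ a (powA t).toNat == 0) (B := fun a t => σ a (powB t).toNat == 0)
    (c := fun _ x => !x) (k := fun _ x y => x && y) (d := fun _ x y => x || y)
    (by fun_prop) (by fun_prop) (by fun_prop) (by fun_prop) (by fun_prop) (by fun_prop)
    (by fun_prop) (fun _ _ _ => rfl) (fun _ _ _ => rfl) (fun _ _ => rfl) (fun _ _ => rfl)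
    (fun _ _ => rfl) (fun _ _ _ => rfl) (fun _ _ _ => rfl)
  exact h.comp (show Primrec fun a => (a, φ a) by fun_prop)

@[fun_prop] theorem primrec_caseIneqs {α : Type*} [Primcodable α] {b c : α → ℕ}
    {σ : α → ℕ → ℕ} {φ : α → QFFormula} (hb : Primrec b) (hc : Primrec c)
    (hσ : Primrec fun p : α × ℕ => σ p.1 p.2) (hφ : Primrec φ) :
    Primrec fun a => (φ a).caseIneqs (b a) (c a) (σ a) := by
  have h := primrec_rec (F := fun a φ => φ.caseIneqs (b a) (c a) (σ a))
    (e := fun a s t => compareCases (σ a (eq s t).toNat) s t)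
    (l := fun a s t => compareCases (σ a (lt s t).toNat) s t)
    (A := fun a t => powerCases (b a) (σ a (powA t).toNat) t (2 * t.toNat))
    (B := fun a t => powerCases (c a) (σ a (powB t).toNat) t (2 * t.toNat + 1))
    (c := fun _ x => x) (k := fun _ x y => x ++ y) (d := fun _ x y => x ++ y)
    (by unfold compareCases; fun_prop) (by unfold compareCases; fun_prop)
    (by unfold powerCases; fun_prop) (by unfold powerCases; fun_prop)
    (by fun_prop) (by fun_prop)
    (by fun_prop) (fun _ _ _ => rfl) (fun _ _ _ => rfl) (fun _ _ => rfl) (fun _ _ => rfl)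
    (fun _ _ => rfl) (fun _ _ _ => rfl) (fun _ _ _ => rfl)
  exact h.comp (show Primrec fun a => (a, φ a) by fun_prop)

theorem caseIneqs_truth_congr (α β : ℕ) {σ τ : ℕ → ℕ} (φ : QFFormula)
    (h : ∀ n ≤ φ.toNat, σ n = τ n) :
    φ.caseIneqs α β σ = φ.caseIneqs α β τ ∧ φ.truth σ = φ.truth τ := by
  induction φ with
  | eq s t => simp only [caseIneqs, truth, h _ le_rfl, and_self]
  | lt s t => simp only [caseIneqs, truth, h _ le_rfl, and_self]
  | powA t => simp only [caseIneqs, truth, h _ le_rfl, and_self]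
  | powB t => simp only [caseIneqs, truth, h _ le_rfl, and_self]
  | not φ ih =>
    simp only [toNat] at h
    have := ih fun n hn => h n (by omega)
    simp only [caseIneqs, truth, this, and_self]
  | and φ ψ ih ih' =>
    simp only [toNat] at h
    have hp := Nat.add_le_pair φ.toNat ψ.toNat
    have h1 := ih fun n hn => h n (by omega)
    have h2 := ih' fun n hn => h n (by omega)
    simp only [caseIneqs, truth, h1, h2, and_self]
  | or φ ψ ih ih' =>
    simp only [toNat] at h
    have hp := Nat.add_le_pair φ.toNat ψ.toNat
    have h1 := ih fun n hn => h n (by omega)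
    have h2 := ih' fun n hn => h n (by omega)
    simp only [caseIneqs, truth, h1, h2, and_self]

end QFFormula

theorem compareCases_spec {d : ℕ} {s t : PATerm} {x z : ℕ → ℤ}
    (h : ∀ r ∈ compareCases d s t, 0 ≤ TermIneq.val x z r) :
    (d = 0 ↔ s.eval x = t.eval x) ∧ (d = 1 ↔ s.eval x < t.eval x) := by
  rcases d with _ | _ | d
  · simp [compareCases, TermIneq.val] at h
    constructor <;> constructor <;> intro _ <;> omega
  · simp [compareCases, TermIneq.val] at h
    constructor <;> constructor <;> intro _ <;> omega
  · simp [compareCases, TermIneq.val] at h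
    constructor <;> constructor <;> intro _ <;> omega

theorem exists_compareCases (s t : PATerm) (x z : ℕ → ℤ) :
    ∃ d < 3, ∀ r ∈ compareCases d s t, 0 ≤ TermIneq.val x z r := by
  rcases lt_trichotomy (s.eval x) (t.eval x) with h | h | h
  · exact ⟨1, by omega, by simp [compareCases, TermIneq.val]; omega⟩
  · exact ⟨0, by omega, by simp [compareCases, TermIneq.val]; omega⟩
  · exact ⟨2, by omega, by simp [compareCases, TermIneq.val]; omega⟩

theorem powerCases_spec {α d i : ℕ} (hα : 1 < α) {t : PATerm} {x z : ℕ → ℤ}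
    (hz : ∃ n : ℕ, z i = (α : ℤ) ^ n) (h : ∀ r ∈ powerCases α d t i, 0 ≤ TermIneq.val x z r) :
    d = 0 ↔ ∃ n : ℕ, t.eval x = (α : ℤ) ^ n := by
  obtain ⟨n, hn⟩ := hz
  have hα' : (1 : ℤ) < α := by exact_mod_cast hα
  rcases d with _ | _ | d
  · simp [powerCases, TermIneq.val] at h
    exact iff_of_true rfl ⟨n, by omega⟩
  · simp [powerCases, TermIneq.val] at h
    refine iff_of_false (by omega) ?_
    rintro ⟨k, hk⟩
    have : 0 < (α : ℤ) ^ k := by positivity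
    omega
  · simp [powerCases, TermIneq.val] at h
    refine iff_of_false (by omega) ?_
    rintro ⟨k, hk⟩
    rw [hn, hk] at h
    have h1 : (α : ℤ) ^ n < (α : ℤ) ^ k := by omega
    have h2 : (α : ℤ) ^ k < (α : ℤ) ^ (n + 1) := by
      rw [pow_succ, mul_comm]
      omega
    have h3 := (pow_lt_pow_iff_right₀ hα').1 h1
    have h4 := (pow_lt_pow_iff_right₀ hα').1 h2
    omega

theorem exists_powerCases {α i : ℕ} {t : PATerm} {x z : ℕ → ℤ}
    (hz : t.eval x ≤ 0 ∨ z i ≤ t.eval x ∧ t.eval x < α * z i) :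
    ∃ d < 3, ∀ r ∈ powerCases α d t i, 0 ≤ TermIneq.val x z r := by
  rcases hz with h | ⟨h, h'⟩
  · exact ⟨1, by omega, by simp [powerCases, TermIneq.val]; omega⟩
  · rcases h.eq_or_lt with h | h
    · exact ⟨0, by omega, by simp [powerCases, TermIneq.val]; omega⟩
    · exact ⟨2, by omega, by simp [powerCases, TermIneq.val]; omega⟩

theorem exists_pow_le_lt {b : ℕ} (hb : 1 < b) (x : ℤ) :
    ∃ n : ℕ, x ≤ 0 ∨ (b : ℤ) ^ n ≤ x ∧ x < b * (b : ℤ) ^ n := by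
  rcases le_or_gt x 0 with h | h
  · exact ⟨0, Or.inl h⟩
  · lift x to ℕ using h.le
    refine ⟨Nat.log b x, Or.inr ⟨?_, ?_⟩⟩
    · exact_mod_cast Nat.pow_log_le_self b (by omega)
    · rw [← pow_succ']
      exact_mod_cast Nat.lt_pow_succ_log_self hb x

namespace QFFormula

theorem truth_iff_holds {α β : ℕ} (hα : 1 < α) (hβ : 1 < β) {σ : ℕ → ℕ} {x z : ℕ → ℤ} {N : ℕ}
    (hz : ∀ j < 2 * (N + 1), ∃ n : ℕ, z j = (zBase α β j : ℤ) ^ n) (φ : QFFormula)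
    (hN : φ.toNat ≤ N) (h : ∀ r ∈ φ.caseIneqs α β σ, 0 ≤ TermIneq.val x z r) :
    φ.truth σ = true ↔ φ.Holds α β x := by
  induction φ with
  | eq s t => simpa [truth, Holds] using (compareCases_spec h).1
  | lt s t => simpa [truth, Holds] using (compareCases_spec h).2
  | powA t =>
    simp only [toNat] at hN
    have := hz (2 * t.toNat) (by omega)
    rw [zBase_even] at this
    simpa [truth, Holds] using powerCases_spec hα this h
  | powB t =>
    simp only [toNat] at hN
    have := hz (2 * t.toNat + 1) (by omega)
    rw [zBase_odd] at this
    simpa [truth, Holds] using powerCases_spec hβ this h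
  | not φ ih =>
    simp only [toNat] at hN
    simp only [truth, Holds, ← ih (by omega) h]
    simp
  | and φ ψ ih ih' =>
    simp only [toNat] at hN
    have hp := Nat.add_le_pair φ.toNat ψ.toNat
    simp only [caseIneqs, List.mem_append] at h
    simp only [truth, Holds, ← ih (by omega) fun r hr => h r (Or.inl hr),
      ← ih' (by omega) fun r hr => h r (Or.inr hr), Bool.and_eq_true]
  | or φ ψ ih ih' =>
    simp only [toNat] at hN
    have hp := Nat.add_le_pair φ.toNat ψ.toNat
    simp only [caseIneqs, List.mem_append] at h
    simp only [truth, Holds, ← ih (by omega) fun r hr => h r (Or.inl hr),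
      ← ih' (by omega) fun r hr => h r (Or.inr hr), Bool.or_eq_true]

theorem exists_cases {α β : ℕ} (hα : 1 < α) (hβ : 1 < β) (x : ℕ → ℤ) :
    ∃ (e : ℕ → ℕ) (σ : ℕ → ℕ), (∀ n, σ n < 3) ∧ ∀ φ : QFFormula,
      ∀ r ∈ φ.caseIneqs α β σ, 0 ≤ TermIneq.val x (fun j => (zBase α β j : ℤ) ^ e j) r := by
  choose e he using fun j : ℕ =>
    exists_pow_le_lt (one_lt_zBase hα hβ j) ((PATerm.ofNat (j / 2)).eval x)
  set z : ℕ → ℤ := fun j => (zBase α β j : ℤ) ^ e j with hz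
  have hA : ∀ t : PATerm, t.eval x ≤ 0 ∨
      z (2 * t.toNat) ≤ t.eval x ∧ t.eval x < α * z (2 * t.toNat) := fun t => by
    have h := he (2 * t.toNat)
    have h2 : 2 * t.toNat / 2 = t.toNat := by omega
    rw [h2, PATerm.ofNat_toNat] at h
    simp only [hz]
    rwa [zBase_even] at h ⊢
  have hB : ∀ t : PATerm, t.eval x ≤ 0 ∨
      z (2 * t.toNat + 1) ≤ t.eval x ∧ t.eval x < β * z (2 * t.toNat + 1) := fun t => by
    have h := he (2 * t.toNat + 1)
    have h2 : (2 * t.toNat + 1) / 2 = t.toNat := by omega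
    rw [h2, PATerm.ofNat_toNat] at h
    simp only [hz]
    rwa [zBase_odd] at h ⊢
  have hd : ∀ φ : QFFormula, ∃ d < 3, match φ with
      | eq s t | lt s t => ∀ r ∈ compareCases d s t, 0 ≤ TermIneq.val x z r
      | powA t => ∀ r ∈ powerCases α d t (2 * t.toNat), 0 ≤ TermIneq.val x z r
      | powB t => ∀ r ∈ powerCases β d t (2 * t.toNat + 1), 0 ≤ TermIneq.val x z r
      | _ => True := fun φ => by
    cases φ with
    | eq s t => exact exists_compareCases s t x z
    | lt s t => exact exists_compareCases s t x z
    | powA t => exact exists_powerCases (hA t)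
    | powB t => exact exists_powerCases (hB t)
    | not φ => exact ⟨0, by omega, trivial⟩
    | and φ ψ => exact ⟨0, by omega, trivial⟩
    | or φ ψ => exact ⟨0, by omega, trivial⟩
  choose d hd3 hd using hd
  refine ⟨e, fun n => d (ofNat n), fun n => hd3 _, fun φ => ?_⟩
  induction φ with
  | eq s t => simpa only [caseIneqs, ofNat_toNat] using hd (eq s t)
  | lt s t => simpa only [caseIneqs, ofNat_toNat] using hd (lt s t)
  | powA t => simpa only [caseIneqs, ofNat_toNat] using hd (powA t)
  | powB t => simpa only [caseIneqs, ofNat_toNat] using hd (powB t)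
  | not φ ih => exact ih
  | and φ ψ ih ih' =>
    intro r hr
    rcases List.mem_append.1 hr with hr | hr
    · exact ih r hr
    · exact ih' r hr
  | or φ ψ ih ih' =>
    intro r hr
    rcases List.mem_append.1 hr with hr | hr
    · exact ih r hr
    · exact ih' r hr

theorem bounds_of_mem_caseIneqs {α β : ℕ} {σ : ℕ → ℕ} {N : ℕ} (φ : QFFormula)
    (hN : φ.toNat ≤ N) {s t : PATerm} {u v a k : ℤ} {i : ℕ}
    (h : (s, t, u, v, a, k, i) ∈ φ.caseIneqs α β σ) :
    s.toNat ≤ N ∧ t.toNat ≤ N ∧ u.natAbs ≤ 1 ∧ v.natAbs ≤ 1 ∧ a.natAbs ≤ α + β + 1 ∧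
      k.natAbs ≤ 1 ∧ i < 2 * (N + 1) := by
  have hcmp : ∀ {d : ℕ} {s' t' : PATerm}, s'.toNat ≤ N → t'.toNat ≤ N →
      (s, t, u, v, a, k, i) ∈ compareCases d s' t' →
      s.toNat ≤ N ∧ t.toNat ≤ N ∧ u.natAbs ≤ 1 ∧ v.natAbs ≤ 1 ∧ a.natAbs ≤ α + β + 1 ∧
      k.natAbs ≤ 1 ∧ i < 2 * (N + 1) := by
    intro d s' t' hs ht h
    rcases d with _ | _ | d <;> simp [compareCases] at h
    · rcases h with ⟨rfl, rfl, rfl, rfl, rfl, rfl, rfl⟩ | ⟨rfl, rfl, rfl, rfl, rfl, rfl, rfl⟩ <;>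
        simp [hs, ht]
    · rcases h with ⟨rfl, rfl, rfl, rfl, rfl, rfl, rfl⟩
      simp [hs, ht]
    · rcases h with ⟨rfl, rfl, rfl, rfl, rfl, rfl, rfl⟩
      simp [hs, ht]
  have hpow : ∀ {d j γ : ℕ} {t' : PATerm}, t'.toNat ≤ N → j < 2 * (N + 1) → γ ≤ α + β →
      (s, t, u, v, a, k, i) ∈ powerCases γ d t' j →
      s.toNat ≤ N ∧ t.toNat ≤ N ∧ u.natAbs ≤ 1 ∧ v.natAbs ≤ 1 ∧ a.natAbs ≤ α + β + 1 ∧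
      k.natAbs ≤ 1 ∧ i < 2 * (N + 1) := by
    intro d j γ t' ht hj hγ h
    rcases d with _ | _ | d <;> simp [powerCases] at h
    · rcases h with ⟨rfl, rfl, rfl, rfl, rfl, rfl, rfl⟩ | ⟨rfl, rfl, rfl, rfl, rfl, rfl, rfl⟩ <;>
        simp [ht, hj]
    · rcases h with ⟨rfl, rfl, rfl, rfl, rfl, rfl, rfl⟩
      simp [ht, hj]
    · rcases h with ⟨rfl, rfl, rfl, rfl, rfl, rfl, rfl⟩ | ⟨rfl, rfl, rfl, rfl, rfl, rfl, rfl⟩ <;>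
        simp [ht, hj]
      omega
  induction φ with
  | eq s' t' =>
    simp only [toNat] at hN
    have hp := Nat.add_le_pair s'.toNat t'.toNat
    exact hcmp (by omega) (by omega) h
  | lt s' t' =>
    simp only [toNat] at hN
    have hp := Nat.add_le_pair s'.toNat t'.toNat
    exact hcmp (by omega) (by omega) h
  | powA t' =>
    simp only [toNat] at hN
    exact hpow (by omega) (by omega) (by omega) h
  | powB t' =>
    simp only [toNat] at hN
    exact hpow (by omega) (by omega) (by omega) h
  | not φ ih =>
    simp only [toNat] at hN
    exact ih (by omega) h
  | and φ ψ ih ih' =>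
    simp only [toNat] at hN
    have hp := Nat.add_le_pair φ.toNat ψ.toNat
    rcases List.mem_append.1 h with h | h
    · exact ih (by omega) h
    · exact ih' (by omega) h
  | or φ ψ ih ih' =>
    simp only [toNat] at hN
    have hp := Nat.add_le_pair φ.toNat ψ.toNat
    rcases List.mem_append.1 h with h | h
    · exact ih (by omega) h
    · exact ih' (by omega) h

/-- The common denominator and height bound for the case inequalities of formulas with code at most
`N`. -/
def ineqBound (α β N : ℕ) : ℕ × ℕ := heightBound (N + 1) (2 * N + α + β + 2) 1

theorem exists_bounded_of_caseIneqs {α β : ℕ} {σ : ℕ → ℕ} (φ : QFFormula) {x z : ℕ → ℤ}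
    (h : ∀ r ∈ φ.caseIneqs α β σ, 0 ≤ TermIneq.val x z r) :
    ∃ y : ℕ → ℤ, (∀ r ∈ φ.caseIneqs α β σ, 0 ≤ TermIneq.val y z r) ∧
      ∀ i ≤ φ.toNat, HasHeight z (2 * (φ.toNat + 1)) (ineqBound α β φ.toNat).2
        ((ineqBound α β φ.toNat).1 * y i) := by
  set N := φ.toNat with hN
  let g : TermIneq → (ℕ → ℤ) × ℤ := fun r =>
    (fun i => r.2.2.1 * r.1.coeff i + r.2.2.2.1 * r.2.1.coeff i,
      r.2.2.1 * r.1.const + r.2.2.2.1 * r.2.1.const + r.2.2.2.2.1 * z r.2.2.2.2.2.2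
        + r.2.2.2.2.2.1)
  have hg : ∀ r ∈ φ.caseIneqs α β σ, ∀ y : ℕ → ℤ, TermIneq.val y z r
      = ∑ i ∈ Finset.range (N + 1), (g r).1 i * y i + (g r).2 := by
    rintro ⟨s, t, u, v, a, k, i⟩ hr y
    obtain ⟨hs, ht, -⟩ := bounds_of_mem_caseIneqs φ hN.ge hr
    simp only [TermIneq.val, g, s.eval_eq_sum_coeff y hs, t.eval_eq_sum_coeff y ht, add_mul,
      Finset.sum_add_distrib, mul_assoc, ← Finset.mul_sum]
    ring
  obtain ⟨y, -, hy, hy'⟩ := exists_solution_hasHeight z (2 * (N + 1)) (N + 1)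
    (2 * N + α + β + 2) 1 one_pos (g '' {r | r ∈ φ.caseIneqs α β σ}) (by
      rintro _ ⟨⟨s, t, u, v, a, k, i⟩, hr, rfl⟩
      obtain ⟨hs, ht, hu, hv, ha, hk, hi⟩ := bounds_of_mem_caseIneqs φ hN.ge hr
      have hmul : ∀ {u w : ℤ} {n : ℕ}, u.natAbs ≤ 1 → w.natAbs ≤ n → n ≤ N →
          (u * w).natAbs ≤ N := fun h1 h2 h3 => by
        rw [Int.natAbs_mul]
        exact (Nat.mul_le_mul h1 (h2.trans h3)).trans (by omega)
      constructor
      · intro j _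
        have h1 := hmul hu (s.natAbs_coeff_le j) hs
        have h2 := hmul hv (t.natAbs_coeff_le j) ht
        simp only [g]
        omega
      · have h1 := hmul hu s.natAbs_const_le hs
        have h2 := hmul hv t.natAbs_const_le ht
        have h3 := (HasHeight.coord (z := z) hi).mul a
        rw [mul_one] at h3
        have h4 := ((((HasHeight.int z (2 * (N + 1)) _).mono h1).add
          ((HasHeight.int z _ _).mono h2)).add (h3.mono ha)).add ((HasHeight.int z _ k).mono hk)
        exact h4.mono (by omega)) x (by
      rintro _ ⟨r, hr, rfl⟩
      rw [← hg r hr]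
      exact h r hr)
  refine ⟨y, fun r hr => ?_, fun i hi => hy' i (by omega)⟩
  rw [hg r hr]
  exact hy _ ⟨r, hr, rfl⟩

end QFFormula

/-! ### Disjunctions of systems of linear inequalities on powers -/

/-- The bases of `J` shared power variables, followed by powers of `a`. -/
def unionBase (a b J l : ℕ) : ℕ := bif Nat.ble J l then a else zBase a b l

/-- A row of coefficients for `J + B + 1` variables. -/
def unionRow (J B : ℕ) (f : ℕ → ℤ) : List ℤ := (List.range (J + B + 1)).map f

/-- The disjunction of the `B` systems `R 0, …, R (B - 1)` of inequalities `∑ cⱼ wⱼ + d ≥ 0`. Each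
system `R c` is relaxed by a power `M_c` of `a`, and `∑ M_c = 1 + (B - 1) M` with a nontrivial power
`M` ensures that some `M_c` equals `1`. -/
def unionSystem (a b J B : ℕ) (R : ℕ → List (List ℤ × ℤ)) : PowerSystem where
  α := a
  β := b
  bases := (List.range (J + B + 1)).map (unionBase a b J)
  ineqs := (unionRow J B fun l => bif l == J + B then 1 else 0, 1) ::
    (List.range B).flatMap fun c => (R c).map fun ρ =>
      (unionRow J B fun l => bif Nat.ble J l then bif l == J + c then 1 else 0 else ρ.1.getD l 0,
        -ρ.2)
  eqns := [(unionRow J B fun l =>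
    bif Nat.ble J l then bif l == J + B then 1 - (B : ℤ) else 1 else 0, 1)]

theorem unionBase_of_lt {a b J l : ℕ} (h : l < J) : unionBase a b J l = zBase a b l := by
  have : Nat.ble J l = false := by rw [← Bool.not_eq_true, Nat.ble_eq]; omega
  simp [unionBase, this]

theorem unionBase_of_ge {a b J l : ℕ} (h : J ≤ l) : unionBase a b J l = a := by
  simp [unionBase, Nat.ble_eq_true_of_le h]

theorem isInstance_unionSystem {a b : ℕ} (ha : 1 < a) (hb : 1 < b) (h : MultIndep a b) (J B : ℕ)
    (R : ℕ → List (List ℤ × ℤ)) : (unionSystem a b J B R).IsInstance := by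
  refine ⟨ha, hb, h, fun z hz => ?_, fun row hrow => ?_, fun row hrow => ?_⟩
  · obtain ⟨l, -, rfl⟩ := List.mem_map.1 hz
    change unionBase a b J l = a ∨ unionBase a b J l = b
    unfold unionBase zBase
    cases Nat.ble J l <;> cases l % 2 == 0 <;> simp
  · simp only [unionSystem, List.mem_cons, List.mem_flatMap, List.mem_map] at hrow
    rcases hrow with rfl | ⟨c, -, ρ, -, rfl⟩ <;> simp [unionSystem, unionRow]
  · simp only [unionSystem, List.mem_singleton] at hrow
    subst hrow
    simp [unionSystem, unionRow]

theorem linForm_unionSystem {a b J B : ℕ} {R : ℕ → List (List ℤ × ℤ)} (f : ℕ → ℤ)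
    (n : Fin (unionSystem a b J B R).bases.length → ℕ) (n' : ℕ → ℕ)
    (hn : ∀ i, n i = n' i) :
    (unionSystem a b J B R).linForm (unionRow J B f) n =
      ∑ l ∈ Finset.range J, f l * (zBase a b l : ℤ) ^ n' l
        + ∑ c ∈ Finset.range B, f (J + c) * (a : ℤ) ^ n' (J + c)
        + f (J + B) * (a : ℤ) ^ n' (J + B) := by
  have hlen : (unionSystem a b J B R).bases.length = J + B + 1 := by simp [unionSystem]
  have h1 : (unionSystem a b J B R).linForm (unionRow J B f) n
      = ∑ i : Fin (unionSystem a b J B R).bases.length,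
        (fun l : ℕ => f l * (unionBase a b J l : ℤ) ^ n' l) i := by
    refine Finset.sum_congr rfl fun i _ => ?_
    have hi : (i : ℕ) < J + B + 1 := hlen ▸ i.2
    have e1 : (unionRow J B f).getD i 0 = f i := by simp [unionRow, hi]
    have e2 : (unionSystem a b J B R).bases.get i = unionBase a b J i := by
      rw [List.get_eq_getElem]
      simp only [unionSystem, List.getElem_map, List.getElem_range]
    rw [e1, e2, hn]
  rw [h1, Fin.sum_univ_eq_sum_range (fun l : ℕ => f l * (unionBase a b J l : ℤ) ^ n' l), hlen,
    Finset.sum_range_succ, Finset.sum_range_add, unionBase_of_ge (by omega)]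
  congr 2
  · refine Finset.sum_congr rfl fun l hl => ?_
    rw [unionBase_of_lt (Finset.mem_range.1 hl)]
  · refine Finset.sum_congr rfl fun l _ => ?_
    rw [unionBase_of_ge (by omega)]

theorem solvable_unionSystem_iff {a b : ℕ} (J B : ℕ) (R : ℕ → List (List ℤ × ℤ)) :
    (unionSystem a b J B R).Solvable ↔ ∃ n : ℕ → ℕ, 1 < (a : ℤ) ^ n (J + B) ∧
      (∀ c < B, ∀ ρ ∈ R c, -ρ.2 < ∑ l ∈ Finset.range J, ρ.1.getD l 0 * (zBase a b l : ℤ) ^ n l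
        + (a : ℤ) ^ n (J + c)) ∧
      ∑ c ∈ Finset.range B, (a : ℤ) ^ n (J + c) = 1 + (B - 1) * (a : ℤ) ^ n (J + B) := by
  have bf : ∀ {l : ℕ}, l < J → Nat.ble J l = false := fun h => by
    rw [← Bool.not_eq_true, Nat.ble_eq]; omega
  have bt : ∀ k, Nat.ble J (J + k) = true := fun k => Nat.ble_eq_true_of_le (by omega)
  have key : ∀ (n : Fin (unionSystem a b J B R).bases.length → ℕ) (n' : ℕ → ℕ),
      (∀ i, n i = n' i) →
      (((∀ row ∈ (unionSystem a b J B R).ineqs,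
          (unionSystem a b J B R).linForm row.1 n > row.2) ∧
        (∀ row ∈ (unionSystem a b J B R).eqns,
          (unionSystem a b J B R).linForm row.1 n = row.2)) ↔
      1 < (a : ℤ) ^ n' (J + B) ∧
      (∀ c < B, ∀ ρ ∈ R c, -ρ.2 < ∑ l ∈ Finset.range J, ρ.1.getD l 0 * (zBase a b l : ℤ) ^ n' l
        + (a : ℤ) ^ n' (J + c)) ∧
      ∑ c ∈ Finset.range B, (a : ℤ) ^ n' (J + c) = 1 + (B - 1) * (a : ℤ) ^ n' (J + B)) := by
    intro n n' hn
    have e1 : (unionSystem a b J B R).linForm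
        (unionRow J B fun l => bif l == J + B then 1 else 0) n = (a : ℤ) ^ n' (J + B) := by
      rw [linForm_unionSystem _ n n' hn, Finset.sum_eq_zero, Finset.sum_eq_zero]
      · simp
      · intro c hc
        have := Finset.mem_range.1 hc
        have h : (J + c == J + B) = false := by simp; omega
        simp [h]
      · intro l hl
        have := Finset.mem_range.1 hl
        have h : (l == J + B) = false := by simp; omega
        simp [h]
    have e2 : ∀ c < B, ∀ ρ : List ℤ × ℤ, (unionSystem a b J B R).linForm
        (unionRow J B fun l => bif Nat.ble J l then bif l == J + c then 1 else 0
          else ρ.1.getD l 0) n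
        = ∑ l ∈ Finset.range J, ρ.1.getD l 0 * (zBase a b l : ℤ) ^ n' l
        + (a : ℤ) ^ n' (J + c) := by
      intro c hc ρ
      rw [linForm_unionSystem _ n n' hn, Finset.sum_eq_single (s := Finset.range B) c]
      · have h : (J + B == J + c) = false := by simp; omega
        simp only [bt, h, cond_true, cond_false, beq_self_eq_true, one_mul, zero_mul, add_zero]
        congr 1
        refine Finset.sum_congr rfl fun l hl => ?_
        rw [bf (Finset.mem_range.1 hl), cond_false]
      · intro d _ hd
        have h : (J + d == J + c) = false := by simpa using hd
        simp [bt, h]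
      · intro h
        exact absurd (Finset.mem_range.2 hc) h
    have e3 : (unionSystem a b J B R).linForm
        (unionRow J B fun l => bif Nat.ble J l then bif l == J + B then 1 - (B : ℤ) else 1
          else 0) n
        = ∑ c ∈ Finset.range B, (a : ℤ) ^ n' (J + c) + (1 - B) * (a : ℤ) ^ n' (J + B) := by
      rw [linForm_unionSystem _ n n' hn, Finset.sum_eq_zero (s := Finset.range J), zero_add]
      · congr 1
        · refine Finset.sum_congr rfl fun c hc => ?_
          have := Finset.mem_range.1 hc
          have h : (J + c == J + B) = false := by simp; omega
          simp only [bt, h, cond_true, cond_false, one_mul]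
        · simp [bt]
      · intro l hl
        rw [bf (Finset.mem_range.1 hl), cond_false, zero_mul]
    have i1 : (unionSystem a b J B R).ineqs =
      (unionRow J B fun l => bif l == J + B then 1 else 0, 1) ::
      (List.range B).flatMap fun c => (R c).map fun ρ =>
        (unionRow J B fun l => bif Nat.ble J l then bif l == J + c then 1 else 0
          else ρ.1.getD l 0, -ρ.2) := rfl
    have i2 : (unionSystem a b J B R).eqns = [(unionRow J B fun l =>
      bif Nat.ble J l then bif l == J + B then 1 - (B : ℤ) else 1 else 0, 1)] := rfl
    rw [i1, i2]
    constructor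
    · rintro ⟨h1, h2⟩
      have h3 := h1 _ List.mem_cons_self
      have h4 := h2 _ List.mem_cons_self
      rw [e1] at h3
      rw [e3] at h4
      refine ⟨h3, fun c hc ρ hρ => ?_, by linarith⟩
      have h5 := h1 _ (List.mem_cons_of_mem _ (List.mem_flatMap.2
        ⟨c, List.mem_range.2 hc, List.mem_map.2 ⟨ρ, hρ, rfl⟩⟩))
      rw [e2 c hc] at h5
      exact h5
    · rintro ⟨h1, h2, h3⟩
      refine ⟨fun row hrow => ?_, fun row hrow => ?_⟩
      · rcases List.mem_cons.1 hrow with rfl | hrow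
        · rw [e1]
          exact h1
        · obtain ⟨c, hc, hrow⟩ := List.mem_flatMap.1 hrow
          obtain ⟨ρ, hρ, rfl⟩ := List.mem_map.1 hrow
          rw [e2 c (List.mem_range.1 hc)]
          exact h2 c (List.mem_range.1 hc) ρ hρ
      · rw [List.mem_singleton] at hrow
        subst hrow
        rw [e3, h3]
        ring
  constructor
  · rintro ⟨n, hn⟩
    let n' : ℕ → ℕ := fun l =>
      if h : l < (unionSystem a b J B R).bases.length then n ⟨l, h⟩ else 0
    exact ⟨n', (key n n' fun i => by simp [n']).1 hn⟩
  · rintro ⟨n, hn⟩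
    exact ⟨fun i => n i, (key _ n fun _ => rfl).2 hn⟩

/-- If a sum of powers of `a` is `1` modulo `a`, then some power is trivial. -/
theorem exists_pow_eq_one {a B : ℕ} (ha : 1 < a) {n : ℕ → ℕ} {k : ℤ}
    (h : ∑ c ∈ Finset.range B, (a : ℤ) ^ n c = 1 + a * k) : ∃ c < B, (a : ℤ) ^ n c = 1 := by
  by_contra! H
  have h1 : (a : ℤ) ∣ ∑ c ∈ Finset.range B, (a : ℤ) ^ n c :=
    Finset.dvd_sum fun c hc => dvd_pow_self _ fun h0 =>
      H c (Finset.mem_range.1 hc) (by rw [h0, pow_zero])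
  rw [h] at h1
  have h2 : (a : ℤ) ∣ 1 := (dvd_add_left (dvd_mul_right _ _)).1 h1
  have h3 := Int.le_of_dvd one_pos h2
  omega

/-- A union system is solvable if and only if one of its members is. -/
theorem solvable_unionSystem {a b : ℕ} (ha : 1 < a) (J B : ℕ) (R : ℕ → List (List ℤ × ℤ)) :
    (unionSystem a b J B R).Solvable ↔ ∃ c < B, ∃ n : ℕ → ℕ, ∀ ρ ∈ R c,
      0 ≤ ∑ l ∈ Finset.range J, ρ.1.getD l 0 * (zBase a b l : ℤ) ^ n l + ρ.2 := by
  rw [solvable_unionSystem_iff]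
  constructor
  · rintro ⟨n, h1, h2, h3⟩
    have h0 : n (J + B) ≠ 0 := fun h => by rw [h, pow_zero] at h1; exact lt_irrefl _ h1
    obtain ⟨k, hk⟩ := dvd_pow_self (a : ℤ) h0
    obtain ⟨c, hc, hc1⟩ := exists_pow_eq_one ha (n := fun c => n (J + c)) (k := (B - 1) * k)
      (by rw [h3, hk]; ring)
    refine ⟨c, hc, n, fun ρ hρ => ?_⟩
    have := h2 c hc ρ hρ
    rw [hc1] at this
    omega
  · rintro ⟨c, hc, n, hn⟩
    let V : List ℤ × ℤ → ℤ := fun ρ =>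
      ∑ l ∈ Finset.range J, ρ.1.getD l 0 * (zBase a b l : ℤ) ^ n l + ρ.2
    obtain ⟨T, hT⟩ := (((List.range B).flatMap fun d => (R d).map fun ρ => -V ρ).finite_toSet).bddAbove
    have hT' : ∀ d < B, ∀ ρ ∈ R d, -V ρ ≤ T := fun d hd ρ hρ =>
      hT (List.mem_flatMap.2 ⟨d, List.mem_range.2 hd, List.mem_map.2 ⟨ρ, hρ, rfl⟩⟩)
    have hlt : T < (a : ℤ) ^ (T.toNat + 1) := by
      have h1 : T.toNat + 1 < a ^ (T.toNat + 1) := Nat.lt_pow_self ha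
      have h2 : ((T.toNat + 1 : ℕ) : ℤ) < (a : ℤ) ^ (T.toNat + 1) := by exact_mod_cast h1
      omega
    let n' : ℕ → ℕ := fun l => if l < J then n l else if l = J + c then 0 else T.toNat + 1
    have hc' : n' (J + c) = 0 := by simp [n']
    have hd' : ∀ d, d ≠ c → n' (J + d) = T.toNat + 1 := fun d hd => by simp [n', hd]
    have hsum : ∀ ρ : List ℤ × ℤ,
        ∑ l ∈ Finset.range J, ρ.1.getD l 0 * (zBase a b l : ℤ) ^ n' l + ρ.2 = V ρ := fun ρ => by
      simp only [V]
      congr 1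
      refine Finset.sum_congr rfl fun l hl => ?_
      simp only [n', if_pos (Finset.mem_range.1 hl)]
    refine ⟨n', ?_, fun d hd ρ hρ => ?_, ?_⟩
    · rw [hd' B (by omega)]
      exact one_lt_pow₀ (by exact_mod_cast ha) (by omega)
    · have h1 := hsum ρ
      by_cases hdc : d = c
      · subst hdc
        rw [hc', pow_zero]
        have : 0 ≤ V ρ := hn ρ hρ
        omega
      · rw [hd' d hdc]
        have := hT' d hd ρ hρ
        omega
    · have h1 : ∀ d ∈ Finset.range B, (a : ℤ) ^ n' (J + d)
          = (a : ℤ) ^ (T.toNat + 1) + if d = c then 1 - (a : ℤ) ^ (T.toNat + 1) else 0 := by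
        intro d _
        split_ifs with hdc
        · rw [hdc, hc']
          ring
        · rw [hd' d hdc, add_zero]
      rw [Finset.sum_congr rfl h1, Finset.sum_add_distrib, Finset.sum_ite_eq' (Finset.range B) c,
        if_pos (Finset.mem_range.2 hc), hd' B (by omega)]
      simp
      ring

@[fun_prop] theorem primrec_zBase {α : Type*} [Primcodable α] {a b l : α → ℕ} (ha : Primrec a)
    (hb : Primrec b) (hl : Primrec l) : Primrec fun x => zBase (a x) (b x) (l x) := by
  unfold zBase
  fun_prop

@[fun_prop] theorem Primrec.list_getD_fun {α β : Type*} [Primcodable α] [Primcodable β]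
    {f : α → List β} {g : α → ℕ} {d : β} (hf : Primrec f) (hg : Primrec g) :
    Primrec fun a => (f a).getD (g a) d := (Primrec.list_getD d).comp hf hg

@[fun_prop] theorem primrec_unionSystem {α : Type*} [Primcodable α] {a b J B : α → ℕ}
    {R : α → ℕ → List (List ℤ × ℤ)} (ha : Primrec a) (hb : Primrec b) (hJ : Primrec J)
    (hB : Primrec B) (hR : Primrec fun p : α × ℕ => R p.1 p.2) :
    Primrec fun x => unionSystem (a x) (b x) (J x) (B x) (R x) := by
  refine (Primrec.of_equiv_iff PowerSystem.equivTuple).1 ?_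
  have h1 : Primrec fun x => (List.range (J x + B x + 1)).map (unionBase (a x) (b x) (J x)) := by
    unfold unionBase
    fun_prop
  have h2 : Primrec fun x => (unionRow (J x) (B x) fun l => bif l == J x + B x then 1 else 0,
      (1 : ℤ)) := by
    unfold unionRow
    fun_prop
  have h3 : Primrec fun x => (List.range (B x)).flatMap fun c => (R x c).map fun ρ =>
      (unionRow (J x) (B x) fun l => bif Nat.ble (J x) l then bif l == J x + c then 1 else 0
        else ρ.1.getD l 0, -ρ.2) := by
    unfold unionRow
    fun_prop
  have h4 : Primrec fun x => (unionRow (J x) (B x) fun l => bif Nat.ble (J x) l then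
      bif l == J x + B x then 1 - (B x : ℤ) else 1 else 0, (1 : ℤ)) := by
    unfold unionRow
    fun_prop
  exact ha.pair (hb.pair (h1.pair ((Primrec.list_cons_fun h2 h3).pair
    (Primrec.list_cons_fun h4 (Primrec.const [])))))

/-! ### Reduction of existential sentences to systems of linear constraints on powers -/

/-- The `i`-th digit of `c` in base `b`. -/
def baseDigit (b c i : ℕ) : ℕ := c / b ^ i % b

theorem exists_baseDigit_eq (b n : ℕ) (f : ℕ → ℕ) (hf : ∀ i < n, f i < b) :
    ∃ c < b ^ n, ∀ i < n, baseDigit b c i = f i := by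
  induction n generalizing f with
  | zero => exact ⟨0, by simp, by simp⟩
  | succ n ih =>
    obtain ⟨c, hc, h⟩ := ih (fun i => f (i + 1)) fun i hi => hf (i + 1) (by omega)
    have h0 := hf 0 (by omega)
    refine ⟨f 0 + b * c, ?_, fun i hi => ?_⟩
    · calc f 0 + b * c < b * (c + 1) := by rw [mul_add]; omega
        _ ≤ b * b ^ n := Nat.mul_le_mul_left _ hc
        _ = b ^ (n + 1) := (pow_succ' b n).symm
    · rcases i with _ | i
      · simp [baseDigit, Nat.mod_eq_of_lt h0]
      · rw [← h i (by omega)]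
        unfold baseDigit
        rw [pow_succ', ← Nat.div_div_eq_div_mul, Nat.add_mul_div_left _ _ (by omega),
          Nat.div_eq_of_lt h0, zero_add]

/-- Powers with exponents at least `Δ!` are periodic modulo `Δ` with period `Δ!`. -/
theorem dvd_pow_add_factorial_mul_sub {Δ : ℕ} (hΔ : 0 < Δ) (b : ℤ) {r : ℕ}
    (hr : Δ.factorial ≤ r) (m : ℕ) : (Δ : ℤ) ∣ b ^ (r + Δ.factorial * m) - b ^ r := by
  obtain ⟨i, p, hp, hip, hdvd⟩ : ∃ i p, 0 < p ∧ i + p ≤ Δ ∧ (Δ : ℤ) ∣ b ^ (i + p) - b ^ i := by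
    have hmaps : ∀ n ∈ Finset.range (Δ + 1), (b ^ n % Δ).toNat ∈ Finset.range Δ := fun n _ => by
      have h1 := Int.emod_nonneg (b ^ n) (b := (Δ : ℤ)) (by omega)
      have h2 := Int.emod_lt_of_pos (b ^ n) (b := (Δ : ℤ)) (by omega)
      rw [Finset.mem_range]
      omega
    obtain ⟨i, hi, j, hj, hij, he⟩ :=
      Finset.exists_ne_map_eq_of_card_lt_of_maps_to (by simp) hmaps
    have hmod : ∀ i j : ℕ, (b ^ i % Δ).toNat = (b ^ j % Δ).toNat → (Δ : ℤ) ∣ b ^ j - b ^ i :=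
      fun i j h => by
        have h1 := Int.emod_nonneg (b ^ i) (b := (Δ : ℤ)) (by omega)
        have h2 := Int.emod_nonneg (b ^ j) (b := (Δ : ℤ)) (by omega)
        exact Int.ModEq.dvd (show b ^ i % Δ = b ^ j % Δ by omega)
    rw [Finset.mem_range] at hi hj
    rcases lt_or_gt_of_ne hij with h | h
    · refine ⟨i, j - i, by omega, by omega, ?_⟩
      rw [Nat.add_sub_cancel' h.le]
      exact hmod i j he
    · refine ⟨j, i - j, by omega, by omega, ?_⟩
      rw [Nat.add_sub_cancel' h.le]
      exact hmod j i he.symm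
  obtain ⟨k, hk⟩ : p ∣ Δ.factorial := Nat.dvd_factorial hp (by omega)
  have hir : i ≤ r := by
    have := Nat.self_le_factorial Δ
    omega
  have hstep : ∀ n : ℕ, (Δ : ℤ) ∣ b ^ (r + p * n) - b ^ r := fun n => by
    have h1 : b ^ p - 1 ∣ (b ^ p) ^ n - 1 ^ n := sub_dvd_pow_sub_pow _ _ _
    rw [one_pow, ← pow_mul] at h1
    obtain ⟨d, hd⟩ := h1
    have h2 : b ^ (r + p * n) - b ^ r = (b ^ (i + p) - b ^ i) * (b ^ (r - i) * d) := by
      have h3 : b ^ r = b ^ i * b ^ (r - i) := by rw [← pow_add, Nat.add_sub_cancel' hir]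
      rw [pow_add, h3, pow_add]
      linear_combination (b ^ i * b ^ (r - i)) * hd
    rw [h2]
    exact hdvd.mul_right _
  have := hstep (k * m)
  rwa [← mul_assoc, ← hk] at this

theorem zBase_pow (α β K j : ℕ) : zBase (α ^ K) (β ^ K) j = zBase α β j ^ K := by
  unfold zBase
  cases j % 2 == 0 <;> rfl

/-- The coefficient of `z_j` (for `j = J` the constant term) in `Δ` times the left side of an
inequality, if `Δ xᵢ` is the affine combination of the `z_j` with coefficients `q i j`. -/
def substCoeff (Δ J : ℕ) (q : ℕ → ℕ → ℤ) (ρ : TermIneq) (j : ℕ) : ℤ :=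
  ρ.2.2.1 * ρ.1.lin (bif j == J then (Δ : ℤ) else 0) (fun i => q i j)
    + ρ.2.2.2.1 * ρ.2.1.lin (bif j == J then (Δ : ℤ) else 0) (fun i => q i j)
    + (bif j == ρ.2.2.2.2.2.2 then Δ * ρ.2.2.2.2.1 else 0)
    + bif j == J then Δ * ρ.2.2.2.2.2.1 else 0

theorem mul_val_eq_sum_substCoeff {Δ J N : ℕ} {q : ℕ → ℕ → ℤ} {x z : ℕ → ℤ}
    (hx : ∀ i ≤ N, Δ * x i = ∑ j ∈ Finset.range J, q i j * z j + q i J) {s t : PATerm}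
    (hs : s.toNat ≤ N) (ht : t.toNat ≤ N) (u v a k : ℤ) {i : ℕ} (hi : i < J) :
    Δ * TermIneq.val x z (s, t, u, v, a, k, i)
      = ∑ j ∈ Finset.range J, substCoeff Δ J q (s, t, u, v, a, k, i) j * z j
        + substCoeff Δ J q (s, t, u, v, a, k, i) J := by
  let w : ℕ → ℤ := fun j => if j < J then z j else 1
  have hw : ∀ f : ℕ → ℤ, ∑ j ∈ Finset.range (J + 1), f j * w j
      = ∑ j ∈ Finset.range J, f j * z j + f J := fun f => by
    rw [Finset.sum_range_succ]
    congr 1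
    · refine Finset.sum_congr rfl fun j hj => ?_
      simp only [w, if_pos (Finset.mem_range.1 hj)]
    · simp [w]
  have hbJ : ∀ c : ℤ, ∑ j ∈ Finset.range (J + 1), (bif j == J then c else 0) * w j = c := fun c => by
    rw [Finset.sum_eq_single J]
    · simp [w]
    · intro j _ hj
      have : (j == J) = false := by simpa using hj
      simp [this]
    · simp
  have hbi : ∀ c : ℤ, ∑ j ∈ Finset.range (J + 1), (bif j == i then c else 0) * w j = c * z i :=
    fun c => by
    rw [Finset.sum_eq_single i]
    · simp [w, hi]
    · intro j _ hj
      have : (j == i) = false := by simpa using hj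
      simp [this]
    · intro h
      exact absurd (Finset.mem_range.2 (by omega)) h
  have hterm := fun (t : PATerm) (ht : t.toNat ≤ N) =>
    t.mul_eval_eq_sum_lin (hbJ Δ).symm (fun i hi => (hx i hi).trans (hw (q i)).symm) ht
  rw [← hw]
  simp only [substCoeff, add_mul, Finset.sum_add_distrib, mul_assoc, ← Finset.mul_sum]
  rw [← hterm s hs, ← hterm t ht, hbi, hbJ]
  simp only [TermIneq.val]
  ring

/-- The system of inequalities for a guess of the cases `σ`, of exponents `r` of the power variables
modulo `K`, and of affine combinations `q` for the values of `Δ xᵢ`. -/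
def caseSystem (α β Δ K : ℕ) (q : ℕ → ℕ → ℤ) (r σ : ℕ → ℕ) (φ : QFFormula) :
    List (List ℤ × ℤ) :=
  ([], bif φ.truth σ then 0 else -1) ::
  ((List.range (φ.toNat + 1)).map (fun i => ([], bif decide ((Δ : ℤ) ∣
    ∑ j ∈ Finset.range (2 * (φ.toNat + 1)), q i j * (zBase α β j : ℤ) ^ r j
      + q i (2 * (φ.toNat + 1))) then 0 else -1)) ++
  ((List.range (2 * (φ.toNat + 1))).map (fun j =>
    ((List.range (2 * (φ.toNat + 1))).map fun l =>
      bif l == j && !Nat.ble K (r j) then -1 else 0, 1)) ++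
  (φ.caseIneqs α β σ).map fun ρ =>
    ((List.range (2 * (φ.toNat + 1))).map fun j =>
      substCoeff Δ (2 * (φ.toNat + 1)) q ρ j * (zBase α β j : ℤ) ^ r j,
      substCoeff Δ (2 * (φ.toNat + 1)) q ρ (2 * (φ.toNat + 1)))))

theorem caseSystem_iff {α β Δ K : ℕ} {q : ℕ → ℕ → ℤ} {r σ : ℕ → ℕ} {φ : QFFormula} {J : ℕ}
    (hJ : J = 2 * (φ.toNat + 1)) (W : ℕ → ℤ) :
    (∀ ρ ∈ caseSystem α β Δ K q r σ φ,
      0 ≤ ∑ l ∈ Finset.range J, ρ.1.getD l 0 * W l + ρ.2) ↔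
    φ.truth σ = true ∧
    (∀ i ≤ φ.toNat, (Δ : ℤ) ∣ ∑ j ∈ Finset.range J, q i j * (zBase α β j : ℤ) ^ r j + q i J) ∧
    (∀ j < J, r j < K → W j ≤ 1) ∧
    ∀ ρ ∈ φ.caseIneqs α β σ, 0 ≤ ∑ j ∈ Finset.range J,
      substCoeff Δ J q ρ j * ((zBase α β j : ℤ) ^ r j * W j) + substCoeff Δ J q ρ J := by
  have hrow : ∀ (f : ℕ → ℤ) (d : ℤ), ∑ l ∈ Finset.range J, ((List.range J).map f).getD l 0 * W l + d
      = ∑ l ∈ Finset.range J, f l * W l + d := fun f d => by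
    congr 1
    refine Finset.sum_congr rfl fun l hl => ?_
    have := Finset.mem_range.1 hl
    simp [this]
  have hbool : ∀ t : Bool, 0 ≤ ∑ l ∈ Finset.range J, (([], bif t then 0 else -1) :
      List ℤ × ℤ).1.getD l 0 * W l + (([], bif t then 0 else -1) : List ℤ × ℤ).2 ↔ t = true :=
    fun t => by cases t <;> simp
  have hone : ∀ j < J, ∀ t : Bool,
      ∑ l ∈ Finset.range J, (bif l == j && t then -1 else 0) * W l + 1
        = bif t then 1 - W j else 1 := fun j hj t => by
    rw [Finset.sum_eq_single j]
    · cases t <;> simp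
      ring
    · intro l _ hl
      have : (l == j) = false := by simpa using hl
      simp [this]
    · intro h
      exact absurd (Finset.mem_range.2 hj) h
  unfold caseSystem
  rw [← hJ]
  simp only [List.forall_mem_cons, List.forall_mem_append, List.forall_mem_map, List.mem_range,
    hbool, hrow, Nat.lt_succ_iff, decide_eq_true_eq]
  refine and_congr Iff.rfl (and_congr Iff.rfl (and_congr ?_ ?_))
  · refine forall_congr' fun j => forall_congr' fun hj => ?_
    rw [hone j hj]
    by_cases h : K ≤ r j
    · have : Nat.ble K (r j) = true := Nat.ble_eq_true_of_le h
      simp [this, h.not_gt]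
    · have : Nat.ble K (r j) = false := by rw [← Bool.not_eq_true, Nat.ble_eq]; exact h
      simp [this, not_le.1 h]
  · simp only [mul_assoc]

/-- The base in which certificates are written. -/
def certBase (α β N : ℕ) : ℕ :=
  2 * (QFFormula.ineqBound α β N).2 + 2 * (QFFormula.ineqBound α β N).1.factorial + 3

/-- The number of certificates. -/
def certCount (α β N : ℕ) : ℕ := certBase α β N ^ (3 * (2 * (N + 1) + 1) ^ 2 + 3)

/-- The coefficients of the affine combinations encoded by the certificate `c`. -/
def certCoeff (α β N c i j : ℕ) : ℤ :=
  baseDigit (certBase α β N) c (3 * Nat.pair i j) - (QFFormula.ineqBound α β N).2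

/-- The exponents encoded by the certificate `c`. -/
def certExp (α β N c j : ℕ) : ℕ := baseDigit (certBase α β N) c (3 * j + 1)

/-- The cases of the atoms encoded by the certificate `c`. -/
def certCase (α β N c n : ℕ) : ℕ := baseDigit (certBase α β N) c (3 * n + 2)

theorem exists_cert {α β N : ℕ} {q : ℕ → ℕ → ℤ} {r σ : ℕ → ℕ}
    (hq : ∀ i ≤ N, ∀ j, (q i j).natAbs ≤ (QFFormula.ineqBound α β N).2)
    (hr : ∀ j, r j < 2 * (QFFormula.ineqBound α β N).1.factorial) (hσ : ∀ n, σ n < 3) :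
    ∃ c < certCount α β N, (∀ i ≤ N, ∀ j ≤ 2 * (N + 1), certCoeff α β N c i j = q i j) ∧
      (∀ j < 2 * (N + 1), certExp α β N c j = r j) ∧ ∀ n ≤ N, certCase α β N c n = σ n := by
  set H := (QFFormula.ineqBound α β N).2 with hH
  let f : ℕ → ℕ := fun k =>
    if k % 3 = 0 then if (k / 3).unpair.1 ≤ N then (q (k / 3).unpair.1 (k / 3).unpair.2 + H).toNat
      else 0
    else if k % 3 = 1 then r (k / 3) else σ (k / 3)
  have hf : ∀ k, f k < certBase α β N := fun k => by
    simp only [f, certBase]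
    split_ifs with h1 h2 h3
    · have := hq _ h2 (k / 3).unpair.2
      omega
    · omega
    · have := hr (k / 3)
      omega
    · have := hσ (k / 3)
      omega
  obtain ⟨c, hc, h⟩ := exists_baseDigit_eq (certBase α β N) (3 * (2 * (N + 1) + 1) ^ 2 + 3) f
    fun k _ => hf k
  have hsq : 2 * (N + 1) + 1 ≤ (2 * (N + 1) + 1) ^ 2 := Nat.le_self_pow (by omega) _
  refine ⟨c, hc, fun i hi j hj => ?_, fun j hj => ?_, fun n hn => ?_⟩
  · have h1 : Nat.pair i j < (2 * (N + 1) + 1) ^ 2 :=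
      (Nat.pair_lt_max_add_one_sq i j).trans_le (Nat.pow_le_pow_left (by omega) 2)
    unfold certCoeff
    rw [h _ (by omega)]
    have h2 : 3 * Nat.pair i j % 3 = 0 := by omega
    have h3 : 3 * Nat.pair i j / 3 = Nat.pair i j := by omega
    have := hq i hi j
    simp only [f, h2, h3, Nat.unpair_pair, if_pos hi, if_true]
    omega
  · unfold certExp
    rw [h _ (by omega)]
    have h2 : (3 * j + 1) % 3 = 1 := by omega
    have h3 : (3 * j + 1) / 3 = j := by omega
    simp [f, h2, h3]
  · unfold certCase
    rw [h _ (by omega)]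
    have h2 : (3 * n + 2) % 3 = 2 := by omega
    have h3 : (3 * n + 2) / 3 = n := by omega
    simp [f, h2, h3]

/-- The power system associated with an existential sentence. -/
def toPowerSystem (α β : ℕ) (φ : QFFormula) : PowerSystem :=
  unionSystem (α ^ (QFFormula.ineqBound α β φ.toNat).1.factorial)
    (β ^ (QFFormula.ineqBound α β φ.toNat).1.factorial) (2 * (φ.toNat + 1))
    (certCount α β φ.toNat) fun c =>
      caseSystem α β (QFFormula.ineqBound α β φ.toNat).1
        (QFFormula.ineqBound α β φ.toNat).1.factorial (certCoeff α β φ.toNat c)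
        (certExp α β φ.toNat c) (certCase α β φ.toNat c) φ

theorem MultIndep.pow {α β K : ℕ} (h : MultIndep α β) (hK : 0 < K) :
    MultIndep (α ^ K) (β ^ K) := fun m n e => by
  rw [← pow_mul, ← pow_mul] at e
  have := h _ _ e
  simpa [hK.ne'] using this

theorem mem_existentialPA_of_solvable {α β : ℕ} (hα : 1 < α) (hβ : 1 < β) {φ : QFFormula}
    {Δ : ℕ} (hΔ : 0 < Δ) {q : ℕ → ℕ → ℤ} {r σ n : ℕ → ℕ} {J : ℕ} (hJ : J = 2 * (φ.toNat + 1))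
    (h : ∀ ρ ∈ caseSystem α β Δ Δ.factorial q r σ φ, 0 ≤ ∑ l ∈ Finset.range J, ρ.1.getD l 0 *
      (zBase (α ^ Δ.factorial) (β ^ Δ.factorial) l : ℤ) ^ n l + ρ.2) :
    φ ∈ ExistentialPA α β := by
  have hpow : ∀ l, (zBase (α ^ Δ.factorial) (β ^ Δ.factorial) l : ℤ) ^ n l
      = (zBase α β l : ℤ) ^ (Δ.factorial * n l) := fun l => by
    rw [zBase_pow, pow_mul]
    push_cast
    rfl
  simp only [hpow] at h
  obtain ⟨h1, h2, h3, h4⟩ := (caseSystem_iff hJ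
    fun l => (zBase α β l : ℤ) ^ (Δ.factorial * n l)).1 h
  simp only [← pow_add] at h4
  have hmod : ∀ j < J, (Δ : ℤ) ∣
      (zBase α β j : ℤ) ^ (r j + Δ.factorial * n j) - (zBase α β j : ℤ) ^ r j := fun j hj => by
    rcases le_or_gt Δ.factorial (r j) with hr | hr
    · exact dvd_pow_add_factorial_mul_sub hΔ _ hr _
    · have h5 := h3 j hj hr
      have h6 : (1 : ℤ) < zBase α β j := by exact_mod_cast one_lt_zBase hα hβ j
      have h7 : Δ.factorial * n j = 0 := by
        by_contra h0
        exact absurd (one_lt_pow₀ h6 h0) (not_lt.2 h5)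
      rw [h7, add_zero, sub_self]
      exact dvd_zero _
  set z : ℕ → ℤ := fun j => (zBase α β j : ℤ) ^ (r j + Δ.factorial * n j) with hz
  have hx : ∀ i, ∃ x : ℤ, i ≤ φ.toNat → Δ * x = ∑ j ∈ Finset.range J, q i j * z j + q i J :=
    fun i => by
    by_cases hi : i ≤ φ.toNat
    · have h5 : (Δ : ℤ) ∣ ∑ j ∈ Finset.range J, q i j * (z j - (zBase α β j : ℤ) ^ r j) :=
        Finset.dvd_sum fun j hj => (hmod j (Finset.mem_range.1 hj)).mul_left _
      have h6 := dvd_add h5 (h2 i hi)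
      rw [← add_assoc, ← Finset.sum_add_distrib] at h6
      obtain ⟨x, hx⟩ := h6
      refine ⟨x, fun _ => hx.symm.trans ?_⟩
      congr 1
      exact Finset.sum_congr rfl fun j _ => by ring
    · exact ⟨0, fun h => absurd h hi⟩
  choose x hx using hx
  refine ⟨x, (φ.truth_iff_holds hα hβ (σ := σ) (z := z) (fun j _ => ⟨_, rfl⟩) le_rfl ?_).1 h1⟩
  rintro ⟨s, t, u, v, a, k, i⟩ hρ
  obtain ⟨hs, ht, -, -, -, -, hi⟩ := φ.bounds_of_mem_caseIneqs le_rfl hρ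
  have h5 := mul_val_eq_sum_substCoeff hx hs ht u v a k (i := i) (by omega)
  have h6 := h4 _ hρ
  rw [← h5] at h6
  exact nonneg_of_mul_nonneg_right h6 (by exact_mod_cast hΔ)

theorem exists_cert_of_mem_existentialPA {α β : ℕ} (hα : 1 < α) (hβ : 1 < β) {φ : QFFormula}
    (hφ : φ ∈ ExistentialPA α β) {Δ J : ℕ} (hΔ : Δ = (QFFormula.ineqBound α β φ.toNat).1)
    (hJ : J = 2 * (φ.toNat + 1)) :
    ∃ c < certCount α β φ.toNat, ∃ n : ℕ → ℕ,
      ∀ ρ ∈ caseSystem α β Δ Δ.factorial (certCoeff α β φ.toNat c) (certExp α β φ.toNat c)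
        (certCase α β φ.toNat c) φ, 0 ≤ ∑ l ∈ Finset.range J, ρ.1.getD l 0 *
          (zBase (α ^ Δ.factorial) (β ^ Δ.factorial) l : ℤ) ^ n l + ρ.2 := by
  obtain ⟨x, hx⟩ := hφ
  obtain ⟨e, σ, hσ, hcase⟩ := QFFormula.exists_cases hα hβ x
  set z : ℕ → ℤ := fun j => (zBase α β j : ℤ) ^ e j with hz
  have htruth : φ.truth σ = true :=
    (φ.truth_iff_holds hα hβ (fun j _ => ⟨_, rfl⟩) le_rfl (hcase φ)).2 hx
  obtain ⟨y, hy, hheight⟩ := φ.exists_bounded_of_caseIneqs (hcase φ)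
  have hq : ∀ i, ∃ q : ℕ → ℤ, i ≤ φ.toNat →
      (∀ j, (q j).natAbs ≤ (QFFormula.ineqBound α β φ.toNat).2) ∧
      Δ * y i = ∑ j ∈ Finset.range J, q j * z j + q J := fun i => by
    by_cases hi : i ≤ φ.toNat
    · obtain ⟨q, h1, h2⟩ := hheight i hi
      rw [hΔ, hJ]
      exact ⟨q, fun _ => ⟨h1, h2⟩⟩
    · exact ⟨0, fun h => absurd h hi⟩
  choose q hq using hq
  have hΔ0 : 0 < Δ := hΔ ▸ heightBound_fst_pos _ _ _
  set K := Δ.factorial with hK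
  have hK0 : 0 < K := Nat.factorial_pos _
  let r : ℕ → ℕ := fun j => if e j < K then e j else K + (e j - K) % K
  let n : ℕ → ℕ := fun j => if e j < K then 0 else (e j - K) / K
  have hrn : ∀ j, r j + K * n j = e j := fun j => by
    simp only [r, n]
    split_ifs with h
    · omega
    · have := Nat.mod_add_div (e j - K) K
      omega
  have hr : ∀ j, r j < 2 * K := fun j => by
    simp only [r]
    split_ifs with h
    · omega
    · have := Nat.mod_lt (e j - K) hK0
      omega
  have hrK : ∀ j, r j < K → n j = 0 := fun j => by
    simp only [r, n]
    split_ifs with h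
    · exact fun _ => rfl
    · intro h
      omega
  obtain ⟨c, hc, hcq, hcr, hcσ⟩ := exists_cert (α := α) (β := β) (N := φ.toNat)
    (fun i hi => (hq i hi).1) (by rw [← hΔ]; exact hr) hσ
  obtain ⟨hrows, htr⟩ := φ.caseIneqs_truth_congr α β hcσ
  refine ⟨c, hc, n, ?_⟩
  have hpow : ∀ l, (zBase (α ^ K) (β ^ K) l : ℤ) ^ n l = (zBase α β l : ℤ) ^ (K * n l) :=
    fun l => by
    rw [zBase_pow, pow_mul]
    push_cast
    rfl
  simp only [hpow]
  have hz' : ∀ j < J, (zBase α β j : ℤ) ^ certExp α β φ.toNat c j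
      * (zBase α β j : ℤ) ^ (K * n j) = z j := fun j hj => by
    rw [hcr j (by omega), ← pow_add, hrn]
  have hmod : ∀ j < J, (Δ : ℤ) ∣ z j - (zBase α β j : ℤ) ^ certExp α β φ.toNat c j :=
    fun j hj => by
    rw [hcr j (by omega)]
    simp only [hz]
    rw [← hrn j]
    rcases le_or_gt K (r j) with h | h
    · exact dvd_pow_add_factorial_mul_sub hΔ0 _ h _
    · rw [hrK j h, mul_zero, add_zero, sub_self]
      exact dvd_zero _
  have hcy : ∀ i ≤ φ.toNat, Δ * y i = ∑ j ∈ Finset.range J, certCoeff α β φ.toNat c i j * z j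
      + certCoeff α β φ.toNat c i J := fun i hi => by
    rw [(hq i hi).2, hcq i hi J hJ.le]
    congr 1
    refine Finset.sum_congr rfl fun j hj => ?_
    have := Finset.mem_range.1 hj
    rw [hcq i hi j (by omega)]
  refine (caseSystem_iff hJ fun l => (zBase α β l : ℤ) ^ (K * n l)).2
    ⟨htr.trans htruth, fun i hi => ?_, fun j hj hj' => ?_, ?_⟩
  · have h5 : (Δ : ℤ) ∣ ∑ j ∈ Finset.range J, certCoeff α β φ.toNat c i j
        * (z j - (zBase α β j : ℤ) ^ certExp α β φ.toNat c j) :=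
      Finset.dvd_sum fun j hj => (hmod j (Finset.mem_range.1 hj)).mul_left _
    have h6 := dvd_sub (Dvd.intro _ (hcy i hi)) h5
    rw [add_sub_right_comm, ← Finset.sum_sub_distrib] at h6
    simpa only [mul_sub, sub_sub_cancel] using h6
  · rw [hcr j (by omega)] at hj'
    rw [hrK j hj', mul_zero, pow_zero]
  · rw [hrows]
    rintro ⟨s, t, u, v, a, k, i⟩ hρ
    obtain ⟨hs, ht, -, -, -, -, hi⟩ := φ.bounds_of_mem_caseIneqs le_rfl hρ
    have h5 := mul_val_eq_sum_substCoeff hcy hs ht u v a k (i := i) (by omega)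
    have h6 : ∑ j ∈ Finset.range J, substCoeff Δ J (certCoeff α β φ.toNat c)
        (s, t, u, v, a, k, i) j * ((zBase α β j : ℤ) ^ certExp α β φ.toNat c j
        * (zBase α β j : ℤ) ^ (K * n j)) = ∑ j ∈ Finset.range J,
        substCoeff Δ J (certCoeff α β φ.toNat c) (s, t, u, v, a, k, i) j * z j :=
      Finset.sum_congr rfl fun j hj => by rw [hz' j (Finset.mem_range.1 hj)]
    rw [h6, ← h5]
    exact mul_nonneg (Int.natCast_nonneg _) (hy _ hρ)

theorem mem_existentialPA_iff_solvable {α β : ℕ} (hα : 1 < α) (hβ : 1 < β) (φ : QFFormula) :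
    φ ∈ ExistentialPA α β ↔ (toPowerSystem α β φ).Solvable := by
  have hΔ : 0 < (QFFormula.ineqBound α β φ.toNat).1 := heightBound_fst_pos _ _ _
  unfold toPowerSystem
  rw [solvable_unionSystem (Nat.one_lt_pow (Nat.factorial_ne_zero _) hα)]
  constructor
  · intro h
    exact exists_cert_of_mem_existentialPA hα hβ h rfl rfl
  · rintro ⟨c, -, n, h⟩
    exact mem_existentialPA_of_solvable hα hβ hΔ rfl h

@[fun_prop] theorem primrec_substCoeff {γ : Type*} [Primcodable γ] {Δ J j : γ → ℕ}
    {q : γ → ℕ → ℕ → ℤ} {ρ : γ → TermIneq} (hΔ : Primrec Δ) (hJ : Primrec J) (hj : Primrec j)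
    (hq : Primrec fun p : γ × ℕ × ℕ => q p.1 p.2.1 p.2.2) (hρ : Primrec ρ) :
    Primrec fun a => substCoeff (Δ a) (J a) (q a) (ρ a) (j a) := by
  have h : Primrec fun p : γ × ℕ => q p.1 p.2 (j p.1) :=
    hq.comp (g := fun p : γ × ℕ => (p.1, p.2, j p.1)) (by fun_prop)
  unfold substCoeff
  fun_prop

@[fun_prop] theorem primrec_caseSystem {γ : Type*} [Primcodable γ] {α β Δ K : γ → ℕ}
    {q : γ → ℕ → ℕ → ℤ} {r σ : γ → ℕ → ℕ} {φ : γ → QFFormula} (hα : Primrec α) (hβ : Primrec β)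
    (hΔ : Primrec Δ) (hK : Primrec K) (hq : Primrec fun p : γ × ℕ × ℕ => q p.1 p.2.1 p.2.2)
    (hr : Primrec fun p : γ × ℕ => r p.1 p.2) (hσ : Primrec fun p : γ × ℕ => σ p.1 p.2)
    (hφ : Primrec φ) :
    Primrec fun a => caseSystem (α a) (β a) (Δ a) (K a) (q a) (r a) (σ a) (φ a) := by
  unfold caseSystem
  fun_prop

@[fun_prop] theorem primrec_ineqBound {γ : Type*} [Primcodable γ] {α β N : γ → ℕ}
    (hα : Primrec α) (hβ : Primrec β) (hN : Primrec N) :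
    Primrec fun a => QFFormula.ineqBound (α a) (β a) (N a) := by
  unfold QFFormula.ineqBound
  fun_prop

@[fun_prop] theorem primrec_baseDigit {γ : Type*} [Primcodable γ] {b c i : γ → ℕ}
    (hb : Primrec b) (hc : Primrec c) (hi : Primrec i) :
    Primrec fun a => baseDigit (b a) (c a) (i a) := by
  unfold baseDigit
  fun_prop

@[fun_prop] theorem primrec_certBase {γ : Type*} [Primcodable γ] {α β N : γ → ℕ}
    (hα : Primrec α) (hβ : Primrec β) (hN : Primrec N) :
    Primrec fun a => certBase (α a) (β a) (N a) := by
  unfold certBase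
  fun_prop

@[fun_prop] theorem primrec_certCount {γ : Type*} [Primcodable γ] {α β N : γ → ℕ}
    (hα : Primrec α) (hβ : Primrec β) (hN : Primrec N) :
    Primrec fun a => certCount (α a) (β a) (N a) := by
  unfold certCount
  fun_prop

@[fun_prop] theorem primrec_certCoeff {γ : Type*} [Primcodable γ] {α β N c i j : γ → ℕ}
    (hα : Primrec α) (hβ : Primrec β) (hN : Primrec N) (hc : Primrec c) (hi : Primrec i)
    (hj : Primrec j) : Primrec fun a => certCoeff (α a) (β a) (N a) (c a) (i a) (j a) := by
  unfold certCoeff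
  fun_prop

@[fun_prop] theorem primrec_certExp {γ : Type*} [Primcodable γ] {α β N c j : γ → ℕ}
    (hα : Primrec α) (hβ : Primrec β) (hN : Primrec N) (hc : Primrec c) (hj : Primrec j) :
    Primrec fun a => certExp (α a) (β a) (N a) (c a) (j a) := by
  unfold certExp
  fun_prop

@[fun_prop] theorem primrec_certCase {γ : Type*} [Primcodable γ] {α β N c n : γ → ℕ}
    (hα : Primrec α) (hβ : Primrec β) (hN : Primrec N) (hc : Primrec c) (hn : Primrec n) :
    Primrec fun a => certCase (α a) (β a) (N a) (c a) (n a) := by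
  unfold certCase
  fun_prop

theorem primrec_toPowerSystem :
    Primrec fun p : ℕ × ℕ × QFFormula => toPowerSystem p.1 p.2.1 p.2.2 := by
  unfold toPowerSystem
  fun_prop

theorem mainTheorem8 :
    (∃ γ : ℕ → ℕ → ℕ, Computable₂ γ ∧
      ∃ f : ℕ × ℕ × QFFormula → QFFormula, Computable f ∧
        ∀ α β : ℕ, 1 < α → 1 < β → ¬ MultIndep α β →
          1 < γ α β ∧
          ∀ φ : QFFormula,
            φ ∈ ExistentialPA α β ↔ f (α, β, φ) ∈ ExistentialPAOne (γ α β)) ∧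
    (∃ f : ℕ × ℕ × QFFormula → PowerSystem, Computable f ∧
        ∀ α β : ℕ, 1 < α → 1 < β → MultIndep α β →
          ∀ φ : QFFormula,
            (f (α, β, φ)).IsInstance ∧
            (φ ∈ ExistentialPA α β ↔ (f (α, β, φ)).Solvable)) := by
  refine ⟨exists_reduction_to_common_root, fun p => toPowerSystem p.1 p.2.1 p.2.2,
    primrec_toPowerSystem.to_comp, fun α β hα hβ h φ => ⟨?_, ?_⟩⟩
  · exact isInstance_unionSystem (Nat.one_lt_pow (Nat.factorial_ne_zero _) hα)
      (Nat.one_lt_pow (Nat.factorial_ne_zero _) hβ) (h.pow (Nat.factorial_pos _)) _ _ _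
  · exact mem_existentialPA_iff_solvable hα hβ φ
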